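/- Let $n\ge 0$, $[n]=\{1,\dots,n\}$, let $\mathcal I_k$ be the set of $k$-element subsets of $[n]$ for $0\le k\le n$, and $\bar I=[n]\setminus I$. Let $\mathcal L=\mathcal L_{\lambda,\mathbf z,y}$ be the ring of rational functions $f/g$ with $f\in\mathbb C[\lambda,z_1,\dots,z_n,y]$ and $g$ a finite product of factors $z_i-z_j$ ($i\ne j$), $z_i-z_j-y$ (all $i,j$) and $\lambda+ly$ ($l\in\mathbb Z$). **Cohomology.** Let $T=(\mathbb C^\times)^n\times\mathbb C^\times$ and use the standard presentation $$H^*_T(T^*\mathrm{Gr}_k(\mathbb C^n))=\mathbb C[\Gamma,\mathbf z,y]^{S_k\times S_{n-k}}\Big/\Big(\prod_{i=1}^k(u-\gamma_{1,i})\prod_{j=1}^{n-k}(u-\gamma_{2,j})-\prod_{a=1}^n(u-z_a)\Big),\qquad \Gamma=\{\gamma_{1,1},\dots,\gamma_{1,k},\gamma_{2,1},\dots,\gamma_{2,n-k}\},$$ where the coefficient of every power of $u$ is a relation. Put $\mathcal X_n=\coprod_{k=0}^nT^*\mathrm{Gr}_k(\mathbb C^n)$, so that $H^*_T(\mathcal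 X_n)\otimes\mathcal L=\bigoplus_{k=0}^nH^*_T(T^*\mathrm{Gr}_k(\mathbb C^n))\otimes_{\mathbb C[\mathbf z,y]}\mathcal L$. For $I\in\mathcal I_k$ the restriction of $[f(\lambda,\Gamma,\mathbf z,y)]$ to the fixed point $x_I$ is $f(\lambda,\mathbf z_I,\mathbf z,y)$, obtained by $\{\gamma_{1,*}\}\mapsto\{z_a\}_{a\in I}$, $\{\gamma_{2,*}\}\mapsto\{z_a\}_{a\in\bar I}$. Similarly, a function of $t_1,\dots,t_k$ is evaluated at $\mathbf z_I$ by substituting the $z_a$, $a\in I$, for the $t_r$. **Weight functions.** For $i\in I$ let $w(i,I)=-\#\{j>i:j\in\bar I\}+\#\{j>i:j\in I\}$. For $I=\{i_1<\dots<i_k\}$ let $l_I(r,a)$ be $t_r-z_a+y$ if $a<i_r$, $\lambda+t_r-z_a-w(i_r,I)y$ if $a=i_r$, and $t_r-z_a$ if $a>i_r$. Put $$W_I(\lambda,\mathbf t,\mathbf z,y)=y^k\,\mathrm{Sym}_{t_1,\dots,t_k}\Big(\prod_{r=1}^k\prod_{a=1}^nl_I(r,a)\prod_{1\le a<b\le k}\frac{t_a-t_b+y}{t_a-t_b}\Big),\qquad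 W_{\sigma,I}(\lambda,\mathbf t,\mathbf z,y)=W_{\sigma^{-1}(I)}(\lambda,\mathbf t,z_{\sigma(1)},\dots,z_{\sigma(n)},y),$$ where $\sigma\in S_n$ and $\mathrm{Sym}$ is the sum over all permutations of the $t_r$. With $e_k=\prod_{a,b=1}^k(t_a-t_b+y)$, $C^{(r)}_I=\prod_{i\in I}(\lambda-(w(i,I)+r)y)$ and $s_0$ the longest permutation in $S_n$, put $$\tilde W^+_I=\frac{W_I}{C^{(0)}_IC^{(1)}_Ie_k},\qquad \tilde W^-_I=\frac{(-1)^k}{e_k}W_{s_0,I}(-\lambda-(n-2k)y,\mathbf t,\mathbf z,y).$$ Put $R_I(\mathbf z)=\prod_{a\in I,\,b\in\bar I}(z_a-z_b)$ and $Q_I(\mathbf z,y)=\prod_{a\in I,\,b\in\bar I}(z_a-z_b+y)$. **Maps.** Let $v_1,v_2$ be the standard basis of $\mathbb C^2$ and $v_I=v_{i_1}\otimes\dots\otimes v_{i_n}\in(\mathbb C^2)^{\otimes n}$ with $i_j=1$ for $j\in I$ and $i_j=2$ for $j\in\bar I$. The dynamical stable envelope map $\mathrm{Stab}_{\mathrm{id}}:(\mathbb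 C^2)^{\otimes n}\otimes\mathcal L\to H^*_T(\mathcal X_n)\otimes\mathcal L$ is the $\mathcal L$-linear map with $v_I\mapsto\kappa_I$ for $I\in\mathcal I_k$, $0\le k\le n$, where $\kappa_I\in H^*_T(T^*\mathrm{Gr}_k(\mathbb C^n))\otimes\mathcal L$ is the class with $\kappa_I|_{x_J}=\tilde W^+_I(\lambda,\mathbf z_J,\mathbf z,y)$ for all $J\in\mathcal I_k$. For $I\in\mathcal I_k$ let $\xi_I=\frac1{Q_I(\mathbf z,y)}\sum_{J\in\mathcal I_k}\tilde W^-_J(\lambda,\mathbf z_I,\mathbf z,y)\,v_J$. Let $\nu:H^*_T(\mathcal X_n)\otimes\mathcal L\to(\mathbb C^2)^{\otimes n}\otimes\mathcal L$ be the $\mathcal L$-linear map with $$\nu([f(\lambda,\Gamma,\mathbf z,y)])=\sum_{I\in\mathcal I_k}\frac{f(\lambda,\mathbf z_I,\mathbf z,y)}{R_I(\mathbf z)}\,\xi_I\qquad\text{for }[f]\in H^*_T(T^*\mathrm{Gr}_k(\mathbb C^n))\otimes\mathcal L,\ 0\le k\le n.$$ **Theorem.** The map $\nu$, given by this formula, and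 $\mathrm{Stab}_{\mathrm{id}}$ are mutually inverse isomorphisms of $\mathcal L$-modules: $\nu\circ\mathrm{Stab}_{\mathrm{id}}=\mathrm{id}$ and $\mathrm{Stab}_{\mathrm{id}}\circ\nu=\mathrm{id}$. Consequently, for all $0\le k\le n$ and $I\in\mathcal I_k$, $$\mathrm{Stab}_{\mathrm{id}}(\xi_I)=\Big[\prod_{i=1}^k\prod_{j\in\bar I}(\gamma_{1,i}-z_j)\Big].$$ -/

import Mathlib

open scoped TensorProduct

noncomputable section

namespace DynStab

/-! ### Coefficient rings -/

/-- The polynomial ring `ℂ[z, y]`, with variables `z₁, …, zₙ` and `y`. -/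
abbrev P (n : ℕ) : Type := MvPolynomial (Fin n ⊕ Unit) ℂ

/-- The variable `z_a` of `ℂ[z, y]`. -/
def zP {n : ℕ} (a : Fin n) : P n := MvPolynomial.X (Sum.inl a)

/-- The variable `y` of `ℂ[z, y]`. -/
def yP (n : ℕ) : P n := MvPolynomial.X (Sum.inr ())

/-- The admissible denominators in `ℂ[λ, z, y] = ℂ[z, y][λ]`: all finite products of factors
`z_i - z_j` (`i ≠ j`), `z_i - z_j - y` (all `i`, `j`) and `λ + l y` (`l ∈ ℤ`). -/
def denominators (n : ℕ) : Submonoid (Polynomial (P n)) :=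
  Submonoid.closure
    ({p | ∃ i j : Fin n, i ≠ j ∧ p = Polynomial.C (zP i - zP j)} ∪
      {p | ∃ i j : Fin n, p = Polynomial.C (zP i - zP j - yP n)} ∪
      {p | ∃ l : ℤ, p = Polynomial.X + Polynomial.C ((l : P n) * yP n)})

/-- The algebra `𝓛_{λ,z,y} = 𝓛_{λ,y} ⊗_{ℂ[y]} 𝓛_{z,y}` of rational functions in `λ, z, y` with the
admissible denominators. -/
def L (n : ℕ) : Type := Localization (denominators n)

instance instCommRingL (n : ℕ) : CommRing (L n) :=
  inferInstanceAs (CommRing (Localization (denominators n)))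

instance instAlgebraPolyL (n : ℕ) : Algebra (Polynomial (P n)) (L n) :=
  inferInstanceAs (Algebra (Polynomial (P n)) (Localization (denominators n)))

instance instIsLocalizationL (n : ℕ) : IsLocalization (denominators n) (L n) :=
  inferInstanceAs (IsLocalization (denominators n) (Localization (denominators n)))

instance instAlgebraL (n : ℕ) : Algebra (P n) (L n) :=
  inferInstanceAs (Algebra (P n) (Localization (denominators n)))

instance instScalarTowerL (n : ℕ) : IsScalarTower (P n) (Polynomial (P n)) (L n) :=
  inferInstanceAs (IsScalarTower (P n) (Polynomial (P n)) (Localization (denominators n)))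

instance instAlgebraComplexL (n : ℕ) : Algebra ℂ (L n) :=
  inferInstanceAs (Algebra ℂ (Localization (denominators n)))

instance instScalarTowerComplexL (n : ℕ) : IsScalarTower ℂ (P n) (L n) :=
  inferInstanceAs (IsScalarTower ℂ (P n) (Localization (denominators n)))

/-- `z_a` as an element of `𝓛_{λ,z,y}`. -/
def z {n : ℕ} (a : Fin n) : L n := algebraMap (P n) (L n) (zP a)

/-- `y` as an element of `𝓛_{λ,z,y}`. -/
def y (n : ℕ) : L n := algebraMap (P n) (L n) (yP n)

/-- `λ` as an element of `𝓛_{λ,z,y}`. -/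
def lam (n : ℕ) : L n := algebraMap (Polynomial (P n)) (L n) Polynomial.X

/-! ### Subsets -/

/-- The set `𝓘_k` of `k`-element subsets of `[n]`. -/
abbrev II (n k : ℕ) : Type := {I : Finset (Fin n) // I.card = k}

/-- The increasing enumeration `i_1 < … < i_k` of `I`. -/
def elt {n k : ℕ} (I : II n k) (r : Fin k) : Fin n := I.1.orderEmbOfFin I.2 r

/-- The complement of `I` in `[n]`. -/
def compl {n k : ℕ} (I : II n k) : II n (n - k) :=
  ⟨I.1ᶜ, by rw [Finset.card_compl, Fintype.card_fin, I.2]⟩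

/-- The subset `σ(I)`. -/
def act {n k : ℕ} (σ : Equiv.Perm (Fin n)) (I : II n k) : II n k :=
  ⟨I.1.map σ.toEmbedding, by rw [Finset.card_map, I.2]⟩

/-- `w(i, I) = - #{j > i, j ∉ I} + #{j > i, j ∈ I}`. -/
def w {n k : ℕ} (i : Fin n) (I : II n k) : ℤ :=
  -(((Finset.univ.filter fun j => i < j ∧ j ∉ I.1).card : ℕ) : ℤ) +
    (((Finset.univ.filter fun j => i < j ∧ j ∈ I.1).card : ℕ) : ℤ)

/-! ### Weight functions

The weight functions are rational expressions in `λ, t, z, y`. They are defined here as functions of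
values of these variables in an arbitrary commutative ring. Division is written with `Ring.inverse`;
it is only used at values for which the denominators are units (see the lemmas `isUnit_…`). -/

section Weight

variable {A : Type*} [CommRing A] {n k : ℕ}

/-- The factor `l_I(r, a)`. -/
def lFactor (I : II n k) (la : A) (t : Fin k → A) (zz : Fin n → A) (yy : A)
    (r : Fin k) (a : Fin n) : A :=
  if a < elt I r then t r - zz a + yy
  else if a = elt I r then la + t r - zz a - (w (elt I r) I : A) * yy
  else t r - zz a

/-- The expression which is symmetrized in the definition of the weight function. -/
def weightTerm (I : II n k) (la : A) (t : Fin k → A) (zz : Fin n → A) (yy : A) : A :=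
  (∏ r : Fin k, ∏ a : Fin n, lFactor I la t zz yy r a) *
    ∏ a : Fin k, ∏ b ∈ Finset.Ioi a, ((t a - t b + yy) * Ring.inverse (t a - t b))

/-- The weight function `W_I(λ, t, z, y)`. -/
def W (I : II n k) (la : A) (t : Fin k → A) (zz : Fin n → A) (yy : A) : A :=
  yy ^ k * ∑ σ : Equiv.Perm (Fin k), weightTerm I la (fun r => t (σ r)) zz yy

/-- The weight function `W_{σ,I}(λ, t, z, y) = W_{σ⁻¹(I)}(λ, t, z_{σ(1)}, …, z_{σ(n)}, y)`. -/
def Wσ (σ : Equiv.Perm (Fin n)) (I : II n k) (la : A) (t : Fin k → A) (zz : Fin n → A)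
    (yy : A) : A :=
  W (act σ⁻¹ I) la t (fun a => zz (σ a)) yy

/-- `e_k(t, y) = ∏_{a,b} (t_a - t_b + y)`. -/
def e (t : Fin k → A) (yy : A) : A := ∏ a : Fin k, ∏ b : Fin k, (t a - t b + yy)

/-- `C^{(r)}_{σ,I} = ∏_{i ∈ I} (λ - (w(σ⁻¹(i), σ⁻¹(I)) + r) y)`. -/
def Cσ (r : ℤ) (σ : Equiv.Perm (Fin n)) (I : II n k) (la yy : A) : A :=
  ∏ i ∈ I.1, (la - ((w (σ⁻¹ i) (act σ⁻¹ I) + r : ℤ) : A) * yy)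

/-- `W̃⁺_{σ,I} = W_{σ,I} / (C⁽⁰⁾_{σ,I} C⁽¹⁾_{σ,I} e_k)`. -/
def Wplus (σ : Equiv.Perm (Fin n)) (I : II n k) (la : A) (t : Fin k → A) (zz : Fin n → A)
    (yy : A) : A :=
  Wσ σ I la t zz yy * Ring.inverse (Cσ 0 σ I la yy * Cσ 1 σ I la yy * e t yy)

/-- `W̃⁻_I = (-1)^k W_{s₀,I}(-λ - (n - 2k) y, t, z, y) / e_k`, where `s₀` is the longest
permutation. -/
def Wminus (I : II n k) (la : A) (t : Fin k → A) (zz : Fin n → A) (yy : A) : A :=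
  (-1) ^ k * Wσ Fin.revPerm I (-la - (((n : ℤ) - 2 * (k : ℤ) : ℤ) : A) * yy) t zz yy *
    Ring.inverse (e t yy)

end Weight

/-- The substitution `z_I` of the variables `t_1, …, t_k`. -/
def zAt {n k : ℕ} (I : II n k) (r : Fin k) : L n := z (elt I r)

/-- `R_I(z) = ∏_{a ∈ I} ∏_{b ∉ I} (z_a - z_b)`. -/
def R {n k : ℕ} (I : II n k) : L n := ∏ a ∈ I.1, ∏ b ∈ I.1ᶜ, (z a - z b)

/-- `Q_I(z, y) = ∏_{a ∈ I} ∏_{b ∉ I} (z_a - z_b + y)`. -/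
def Q {n k : ℕ} (I : II n k) : L n := ∏ a ∈ I.1, ∏ b ∈ I.1ᶜ, (z a - z b + y n)

/-! All denominators that occur are units of `𝓛_{λ,z,y}`. -/

lemma isUnit_of_mem {n : ℕ} {p : Polynomial (P n)} (hp : p ∈ denominators n) :
    IsUnit (algebraMap (Polynomial (P n)) (L n) p) :=
  IsLocalization.map_units (L n) (⟨p, hp⟩ : denominators n)

lemma algebraMap_C {n : ℕ} (p : P n) :
    algebraMap (Polynomial (P n)) (L n) (Polynomial.C p) = algebraMap (P n) (L n) p :=
  (IsScalarTower.algebraMap_apply (P n) (Polynomial (P n)) (L n) p).symm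

lemma isUnit_sub {n : ℕ} {i j : Fin n} (h : i ≠ j) : IsUnit (z i - z j : L n) := by
  have := isUnit_of_mem (n := n) (p := Polynomial.C (zP i - zP j))
    (Submonoid.subset_closure (Or.inl (Or.inl ⟨i, j, h, rfl⟩)))
  rwa [algebraMap_C, map_sub] at this

lemma isUnit_sub_add {n : ℕ} (i j : Fin n) : IsUnit (z i - z j + y n : L n) := by
  have := isUnit_of_mem (n := n) (p := Polynomial.C (zP j - zP i - yP n))
    (Submonoid.subset_closure (Or.inl (Or.inr ⟨j, i, rfl⟩)))
  rw [algebraMap_C, map_sub, map_sub] at this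
  have h2 := this.neg
  have : -(z j - z i - y n : L n) = z i - z j + y n := by ring
  rw [← this]
  exact h2

lemma isUnit_lam {n : ℕ} (l : ℤ) : IsUnit (lam n - (l : L n) * y n) := by
  have := isUnit_of_mem (n := n) (p := Polynomial.X + Polynomial.C (((-l : ℤ) : P n) * yP n))
    (Submonoid.subset_closure (Or.inr ⟨-l, rfl⟩))
  rw [map_add, algebraMap_C, map_mul, map_intCast] at this
  have h2 : (lam n - (l : L n) * y n) = lam n + ((-l : ℤ) : L n) * y n := by push_cast; ring
  rw [h2]
  exact this

lemma isUnit_zAt_sub {n k : ℕ} (I : II n k) {a b : Fin k} (h : a ≠ b) :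
    IsUnit (zAt I a - zAt I b) :=
  isUnit_sub fun hab => h ((I.1.orderEmbOfFin I.2).injective hab)

lemma isUnit_e {n k : ℕ} (I : II n k) : IsUnit (e (zAt I) (y n)) := by
  simp only [e, IsUnit.prod_univ_iff]
  exact fun a b => isUnit_sub_add _ _

lemma isUnit_C {n k : ℕ} (r : ℤ) (σ : Equiv.Perm (Fin n)) (I : II n k) :
    IsUnit (Cσ r σ I (lam n) (y n)) := by
  simp only [Cσ, IsUnit.prod_iff]
  exact fun a _ => isUnit_lam _

lemma isUnit_R {n k : ℕ} (I : II n k) : IsUnit (R I) := by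
  simp only [R, IsUnit.prod_iff]
  refine fun a ha b hb => isUnit_sub ?_
  rintro rfl
  exact (Finset.mem_compl.1 hb) ha

lemma isUnit_Q {n k : ℕ} (I : II n k) : IsUnit (Q I) := by
  simp only [Q, IsUnit.prod_iff]
  exact fun a _ b _ => isUnit_sub_add _ _

/-! ### Equivariant cohomology of `T^*Gr_k(ℂⁿ)`, through its standard presentation -/

/-- The ring `ℂ[Γ, z, y] = ℂ[z, y][Γ]`, where `Sum.inl i` indexes `γ_{1,i}` and `Sum.inr j` indexes
`γ_{2,j}`. -/
abbrev PΓ (n k : ℕ) : Type := MvPolynomial (Fin k ⊕ Fin (n - k)) (P n)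

/-- The `ℂ[z, y]`-algebra `ℂ[Γ, z, y]^{S_k × S_{n-k}}`. -/
def invariants (n k : ℕ) : Subalgebra (P n) (PΓ n k) where
  carrier := {f | ∀ (s : Equiv.Perm (Fin k)) (t : Equiv.Perm (Fin (n - k))),
    MvPolynomial.rename (Sum.map s t) f = f}
  mul_mem' hf hg s t := by rw [map_mul, hf s t, hg s t]
  add_mem' hf hg s t := by rw [map_add, hf s t, hg s t]
  algebraMap_mem' r s t := AlgHom.commutes _ r

instance instCommRingInvariants (n k : ℕ) : CommRing (invariants n k) :=
  Subalgebra.toCommRing (invariants n k)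

/-- The polynomial `∏ (u - γ_{1,i}) ∏ (u - γ_{2,j}) - ∏ (u - z_a)` in `u`. -/
def relationPoly (n k : ℕ) : Polynomial (PΓ n k) :=
  (∏ i : Fin k, (Polynomial.X - Polynomial.C (MvPolynomial.X (Sum.inl i)))) *
      (∏ j : Fin (n - k), (Polynomial.X - Polynomial.C (MvPolynomial.X (Sum.inr j)))) -
    ∏ a : Fin n, (Polynomial.X - Polynomial.C (MvPolynomial.C (zP a)))

/-- The coefficient of `u ^ m` in the above polynomial, as an invariant. -/
def relation (n k m : ℕ) : invariants n k :=
  ⟨(relationPoly n k).coeff m, by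
    intro s t
    have h : (relationPoly n k).map
        (MvPolynomial.rename (R := P n) (Sum.map s t)).toRingHom = relationPoly n k := by
      simp only [relationPoly, Polynomial.map_sub, Polynomial.map_mul, Polynomial.map_prod,
        Polynomial.map_X, Polynomial.map_C, AlgHom.toRingHom_eq_coe, RingHom.coe_coe,
        MvPolynomial.rename_X, MvPolynomial.rename_C, Sum.map_inl, Sum.map_inr]
      rw [Equiv.prod_comp s fun i : Fin k => (Polynomial.X - Polynomial.C
          (MvPolynomial.X (Sum.inl i)) : Polynomial (PΓ n k)),
        Equiv.prod_comp t fun i : Fin (n - k) => (Polynomial.X - Polynomial.C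
          (MvPolynomial.X (Sum.inr i)) : Polynomial (PΓ n k))]
    conv_rhs => rw [← h]
    rw [Polynomial.coeff_map]
    rfl⟩

/-- `H^*_T(T^*Gr_k(ℂⁿ)) = ℂ[Γ, z, y]^{S_k × S_{n-k}} / (coefficients of the above polynomial)`. -/
def H (n k : ℕ) : Type :=
  invariants n k ⧸ Ideal.span (Set.range (relation n k))

instance instCommRingH (n k : ℕ) : CommRing (H n k) := Ideal.Quotient.commRing _

instance instAlgebraH (n k : ℕ) : Algebra (P n) (H n k) :=
  Ideal.Quotient.algebra (P n) (A := invariants n k)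

/-- `H^*_T(T^*Gr_k(ℂⁿ)) ⊗ 𝓛_{λ,z,y}`, the tensor product being over `ℂ[z, y]`. -/
abbrev HL (n k : ℕ) : Type := L n ⊗[P n] H n k

/-- `H^*_T(𝓧_n) ⊗ 𝓛_{λ,z,y} = ⨁_{k=0}^n H^*_T(T^*Gr_k(ℂⁿ)) ⊗ 𝓛_{λ,z,y}`, where `𝓧_n` is the
disjoint union of the `T^*Gr_k(ℂⁿ)`. -/
abbrev HXL (n : ℕ) : Type := (k : Fin (n + 1)) → HL n k

/-- The class `[f]` in `H^*_T(T^*Gr_k(ℂⁿ))` of an invariant polynomial `f`. -/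
def cls {n k : ℕ} (f : invariants n k) : H n k :=
  Ideal.Quotient.mk (Ideal.span (Set.range (relation n k))) f

/-- The inclusion of the summand `H^*_T(T^*Gr_k(ℂⁿ)) ⊗ 𝓛_{λ,z,y}` in
`H^*_T(𝓧_n) ⊗ 𝓛_{λ,z,y}`. -/
def incl {n : ℕ} (k : Fin (n + 1)) : HL n k →ₗ[L n] HXL n :=
  LinearMap.single (L n) (fun k : Fin (n + 1) => HL n k) k

/-- The substitution `f ↦ f(z_I, z, y)` on `ℂ[Γ, z, y]`: the `γ_{1,*}` go to the `z_a` with `a ∈ I`,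
the `γ_{2,*}` to the `z_a` with `a ∉ I`. -/
def subst {n k : ℕ} (I : II n k) : PΓ n k →ₐ[P n] P n :=
  MvPolynomial.aeval (Sum.elim (fun i => zP (elt I i)) fun j => zP (elt (compl I) j))

lemma prod_elt {n k : ℕ} (I : II n k) {A : Type*} [CommMonoid A] (f : Fin n → A) :
    ∏ i : Fin k, f (elt I i) = ∏ a ∈ I.1, f a := by
  rw [← Finset.map_orderEmbOfFin_univ I.1 I.2, Finset.prod_map]
  rfl

lemma subst_relation {n k : ℕ} (I : II n k) (m : ℕ) :
    subst I (relation n k m : PΓ n k) = 0 := by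
  have h : (relationPoly n k).map (subst I).toRingHom = 0 := by
    simp only [relationPoly, Polynomial.map_sub, Polynomial.map_mul, Polynomial.map_prod,
      Polynomial.map_X, Polynomial.map_C, AlgHom.toRingHom_eq_coe, RingHom.coe_coe, subst,
      MvPolynomial.aeval_X, MvPolynomial.aeval_C, Sum.elim_inl, Sum.elim_inr, Algebra.algebraMap_self,
      RingHom.id_apply]
    rw [prod_elt I fun a => (Polynomial.X - Polynomial.C (zP a) : Polynomial (P n)),
      prod_elt (compl I) fun a => (Polynomial.X - Polynomial.C (zP a) : Polynomial (P n))]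
    simp only [compl]
    rw [Finset.prod_mul_prod_compl, sub_self]
  have := congrArg (fun p => Polynomial.coeff p m) h
  simp only [Polynomial.coeff_map, Polynomial.coeff_zero] at this
  exact this

/-- The localization component `Loc_I : H^*_T(T^*Gr_k(ℂⁿ)) → ℂ[z, y]`, `[f] ↦ f(z_I, z, y)`. -/
def loc {n k : ℕ} (I : II n k) : H n k →ₐ[P n] P n :=
  Ideal.Quotient.liftₐ _ ((subst I).comp (invariants n k).val) (by
    intro a ha
    have hle : Ideal.span (Set.range (relation n k)) ≤
        RingHom.ker ((subst I).comp (invariants n k).val) := by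
      rw [Ideal.span_le]
      rintro _ ⟨m, rfl⟩
      exact subst_relation I m
    exact hle ha)

/-- The restriction `[f] ↦ f(λ, z_I, z, y)` to the fixed point `x_I`, after extension of
coefficients. -/
def restr {n k : ℕ} (I : II n k) : HL n k →ₐ[L n] L n :=
  Algebra.TensorProduct.lift (AlgHom.id (L n) (L n)) ((Algebra.ofId (P n) (L n)).comp (loc I))
    fun _ _ => Commute.all _ _

/-- The invariant polynomial `∏_{i=1}^k ∏_{j ∉ I} (γ_{1,i} - z_j)`. -/
def fixedPoly {n k : ℕ} (I : II n k) : invariants n k :=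
  ⟨∏ i : Fin k, ∏ j ∈ I.1ᶜ, (MvPolynomial.X (Sum.inl i) - MvPolynomial.C (zP j)), by
    intro s t
    simp only [map_prod, map_sub, MvPolynomial.rename_X, MvPolynomial.rename_C, Sum.map_inl]
    exact Equiv.prod_comp s fun i : Fin k => ∏ j ∈ I.1ᶜ,
      (MvPolynomial.X (Sum.inl i) - MvPolynomial.C (zP j) : PΓ n k)⟩

lemma restr_tmul {n k : ℕ} (I : II n k) (c : L n) (f : invariants n k) :
    restr I (c ⊗ₜ cls f) = c * algebraMap (P n) (L n) (subst I (f : PΓ n k)) := rfl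

lemma subst_fixedPoly {n k : ℕ} (I J : II n k) :
    algebraMap (P n) (L n) (subst I (fixedPoly J : PΓ n k)) = if J = I then R J else 0 := by
  have h : algebraMap (P n) (L n) (subst I (fixedPoly J : PΓ n k)) =
      ∏ a ∈ I.1, ∏ b ∈ J.1ᶜ, (z a - z b) := by
    rw [← prod_elt I fun a => ∏ b ∈ J.1ᶜ, (z a - z b)]
    simp [fixedPoly, subst, z]
  rw [h]
  split_ifs with hJI
  · subst hJI; rfl
  · obtain ⟨a, haI, haJ⟩ : ∃ a ∈ I.1, a ∉ J.1 := by
      by_contra! hc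
      exact hJI (Subtype.ext (Finset.eq_of_subset_of_card_le hc (by rw [I.2, J.2])).symm)
    exact Finset.prod_eq_zero haI
      (Finset.prod_eq_zero (Finset.mem_compl.2 haJ) (sub_self _))

/-- Classes with arbitrary prescribed restrictions to the fixed points exist over
`𝓛_{λ,z,y}`. -/
lemma exists_restr {n k : ℕ} (g : II n k → L n) : ∃ κ : HL n k, ∀ J, restr J κ = g J := by
  refine ⟨∑ I : II n k, (g I * Ring.inverse (R I)) ⊗ₜ cls (fixedPoly I), fun J => ?_⟩
  simp only [map_sum, restr_tmul, subst_fixedPoly, mul_ite, mul_zero, Finset.sum_ite_eq',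
    Finset.mem_univ, if_true]
  rw [mul_assoc, Ring.inverse_mul_cancel _ (isUnit_R J), mul_one]

/-! ### The space `(ℂ²)^{⊗n} ⊗ 𝓛_{λ,z,y}` -/

/-- `(ℂ²)^{⊗n} ⊗ 𝓛_{λ,z,y} = H^*_T((𝓧_n)^T) ⊗ 𝓛_{λ,z,y}`. -/
abbrev V (n : ℕ) : Type := L n ⊗[ℂ] (⨂[ℂ] _ : Fin n, (Fin 2 → ℂ))

/-- The vector `v_I = v_{i_1} ⊗ … ⊗ v_{i_n}`, `i_j = 1` for `j ∈ I` and `i_j = 2` for `j ∉ I`. Here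
the standard basis `v_1, v_2` of `ℂ²` is indexed by `0, 1 : Fin 2`. -/
def v {n : ℕ} (I : Finset (Fin n)) : V n :=
  1 ⊗ₜ PiTensorProduct.tprod ℂ fun j => Pi.single (if j ∈ I then (0 : Fin 2) else 1) (1 : ℂ)

/-- Subsets of `[n]` as functions `[n] → {1, 2}`. -/
def indexEquiv (n : ℕ) : (Fin n → Fin 2) ≃ Finset (Fin n) where
  toFun p := Finset.univ.filter fun j => p j = 0
  invFun I j := if j ∈ I then 0 else 1
  left_inv p := by
    funext j
    by_cases h : p j = 0
    · simp [h]
    · simp only [Finset.mem_filter, Finset.mem_univ, true_and, h, if_false]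
      omega
  right_inv I := by
    ext j
    by_cases h : j ∈ I <;> simp [h]

/-- The vectors `v_I` as a basis of `(ℂ²)^{⊗n} ⊗ 𝓛_{λ,z,y}`. -/
def vBasis (n : ℕ) : Module.Basis (Finset (Fin n)) (L n) (V n) :=
  ((Basis.piTensorProduct fun _ : Fin n => Pi.basisFun ℂ (Fin 2)).baseChange (L n)).reindex
    (indexEquiv n)

lemma vBasis_apply {n : ℕ} (I : Finset (Fin n)) : vBasis n I = v I := by
  simp [vBasis, v, indexEquiv]

/-! ### Stable envelopes and the map `ν` -/

/-- The class `κ_{σ,I}`, with `κ_{σ,I}|_{x_J} = W̃⁺_{σ,I}(λ, z_J, z, y)` for all `J`. -/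
def kappa {n k : ℕ} (σ : Equiv.Perm (Fin n)) (I : II n k) : HL n k :=
  (exists_restr fun J : II n k => Wplus σ I (lam n) (zAt J) z (y n)).choose

lemma restr_kappa {n k : ℕ} (σ : Equiv.Perm (Fin n)) (I J : II n k) :
    restr J (kappa σ I) = Wplus σ I (lam n) (zAt J) z (y n) :=
  (exists_restr fun J : II n k => Wplus σ I (lam n) (zAt J) z (y n)).choose_spec J

/-- The number of elements of a subset of `[n]`, as an element of `{0, …, n}`. -/
def size {n : ℕ} (I : Finset (Fin n)) : Fin (n + 1) :=
  ⟨I.card, Nat.lt_succ_of_le (by simpa using I.card_le_univ)⟩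

/-- The dynamical stable envelope map `Stab_σ`, the `𝓛_{λ,z,y}`-linear map with
`v_I ↦ κ_{σ,I}`. -/
def Stab {n : ℕ} (σ : Equiv.Perm (Fin n)) : V n →ₗ[L n] HXL n :=
  (vBasis n).constr ℕ fun I => incl (size I) (kappa σ ⟨I, rfl⟩)

lemma Stab_v {n : ℕ} (σ : Equiv.Perm (Fin n)) {k : Fin (n + 1)} (I : II n k) :
    Stab σ (v I.1) = incl k (kappa σ I) := by
  obtain ⟨I, hI⟩ := I
  obtain rfl : size I = k := Fin.ext hI
  rw [← vBasis_apply, Stab, Module.Basis.constr_basis]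

/-- `ξ_I = Q_I(z, y)⁻¹ ∑_{J ∈ 𝓘_k} W̃⁻_J(λ, z_I, z, y) v_J`. -/
def xi {n k : ℕ} (I : II n k) : V n :=
  Ring.inverse (Q I) • ∑ J : II n k, Wminus J (lam n) (zAt I) z (y n) • v J.1

/-- The `𝓛_{λ,z,y}`-linear map `ν`, which sends a class `[f]` on `T^*Gr_k(ℂⁿ)` to
`∑_{I ∈ 𝓘_k} f(λ, z_I, z, y) / R_I(z) ξ_I`. -/
def nu (n : ℕ) : HXL n →ₗ[L n] V n :=
  ∑ k : Fin (n + 1), ∑ I : II n k,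
    (((restr I).toLinearMap ∘ₗ LinearMap.proj k).smulRight (Ring.inverse (R I) • xi I))

end DynStab

end

noncomputable section

namespace DynStab

/-! Both compositions reduce to one orthogonality relation over the fixed points,
`sum_Wplus_mul_Wminus`: the sum over K of W̃⁺_I(z_K) W̃⁻_J(z_K) / (R_K Q_K) is δ_{IJ}. It says that
two square matrices over 𝓛 are inverse to each other in one order, hence also in the other. The
first order is ν ∘ Stab = id. The second computes the restrictions of Stab(ξ_I), which turn out to
be those of the class of ∏ (γ_{1,i} - z_j). Since a class over 𝓛 is determined by its restrictions
(`eq_of_restr_eq`), Stab(ξ_I) is this class. Every class is the combination of these classes given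
by its restrictions divided by R_I, whence Stab ∘ ν = id.

The orthogonality is proved in the fraction field of 𝓛 by induction on the number of nodes, removing
the first node x = z_1 (`sum_wPlus_mul_wMinus`). For this the weight functions are rewritten
recursively as functions of a list of nodes and a set of values of the t's (`shuffleSum`,
`symSum_eq_shuffleSum`). If x ∈ I, the plus function vanishes at every K without x; if x ∉ J, the
minus function vanishes at every K with x. So three of the four cases reduce term by term to the
shorter list, a common element x contributing its factors of C⁽⁰⁾ and C⁽¹⁾. In the case x ∉ I, x ∈
J, let s be the value that the minus function uses at x and fix the other values K. The sum over s
is then a sum of residues of a rational function of s (`sum_residues_wPlus`): there is no residue on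
K, zeros of the plus function cancel the poles at b - y, and the linear factor of the minus function
at x is exactly the one that removes the residue at infinity.

For the injectivity of restriction, averaging over S_k × S_{n-k} embeds the cohomology into the
quotient of the full polynomial ring in the γ's. There, after extension to 𝓛, Lagrange interpolation
splits 1 into idempotents indexed by assignments of nodes to the γ's; only bijective assignments
survive, and on each of them an invariant class acts by its restriction to a fixed point. -/

open Polynomial in
/-- `P` has degree at most `d`, and its coefficients satisfy `P = A (X ^ d + c X ^ (d - 1)) + …`. -/
def TopTwo {F : Type*} [Field F] (d : ℕ) (c : F) (P : Polynomial F) : Prop :=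
  P.natDegree ≤ d ∧ (P.reflect d).coeff 1 = c * (P.reflect d).coeff 0

/-! ### Residue theorem through the two leading coefficients. -/

section TopTwo

open Polynomial

variable {F : Type*} [Field F]

/-- Reflection moves the two leading coefficients to degrees 0 and 1, where the product rule makes
the ratios add. It also keeps d = 0 meaningful, which truncated subtraction in d - 1 would not. -/
lemma TopTwo.mul {d d' : ℕ} {c c' : F} {p q : F[X]} (hp : TopTwo d c p) (hq : TopTwo d' c' q) :
    TopTwo (d + d') (c + c') (p * q) := by
  refine ⟨natDegree_mul_le_of_le hp.1 hq.1, ?_⟩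
  rw [reflect_mul _ _ hp.1 hq.1, mul_coeff_one, mul_coeff_zero, hp.2, hq.2]
  ring

lemma TopTwo.add {d : ℕ} {c : F} {p q : F[X]} (hp : TopTwo d c p) (hq : TopTwo d c q) :
    TopTwo d c (p + q) := by
  refine ⟨natDegree_add_le_of_degree_le hp.1 hq.1, ?_⟩
  rw [reflect_add, coeff_add, coeff_add, hp.2, hq.2, mul_add]

lemma TopTwo.zero (d : ℕ) (c : F) : TopTwo d c 0 := by
  simp [TopTwo]

lemma TopTwo.sum {ι : Type*} {d : ℕ} {c : F} {s : Finset ι} {p : ι → F[X]}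
    (hp : ∀ i ∈ s, TopTwo d c (p i)) : TopTwo d c (∑ i ∈ s, p i) := by
  classical
  induction s using Finset.induction_on with
  | empty => simpa using TopTwo.zero d c
  | insert a s ha ih =>
    rw [Finset.sum_insert ha]
    exact (hp a (by simp)).add (ih fun i hi => hp i (by simp [hi]))

lemma TopTwo.const (a : F) : TopTwo 0 0 (C a) := by
  simp [TopTwo]

lemma TopTwo.C_mul {d : ℕ} {c : F} {p : F[X]} (a : F) (hp : TopTwo d c p) :
    TopTwo d c (C a * p) := by
  simpa using (TopTwo.const a).mul hp

lemma TopTwo.X_add (b : F) : TopTwo 1 b (X + C b) := by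
  refine ⟨by simp, ?_⟩
  simp [coeff_X, coeff_C, coeff_one]

lemma TopTwo.prod {ι : Type*} (s : Finset ι) (f : ι → F) :
    TopTwo s.card (∑ i ∈ s, f i) (∏ i ∈ s, (X + C (f i))) := by
  classical
  induction s using Finset.induction_on with
  | empty => simpa using TopTwo.const (1 : F)
  | insert a s ha ih =>
    rw [Finset.prod_insert ha, Finset.sum_insert ha, Finset.card_insert_of_notMem ha, add_comm s.card]
    exact (TopTwo.X_add _).mul ih

lemma TopTwo.list_prod {ι : Type*} (l : List ι) (f : ι → F) :
    TopTwo l.length (l.map f).sum (l.map fun i => X + C (f i)).prod := by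
  induction l with
  | nil => simpa using TopTwo.const (1 : F)
  | cons a l ih =>
    rw [List.length_cons, List.map_cons, List.map_cons, List.sum_cons, List.prod_cons, add_comm l.length]
    exact (TopTwo.X_add _).mul ih

/-- Residue theorem for a rational function which has no residue at infinity. -/
lemma TopTwo.sum_div_eq_zero [DecidableEq F] {N : Finset F} {P : F[X]} (h0 : N.Nonempty)
    (h : TopTwo N.card (-∑ s ∈ N, s) P) :
    ∑ s ∈ N, P.eval s / ∏ b ∈ N.erase s, (s - b) = 0 := by
  obtain ⟨e, he⟩ : ∃ e, N.card = e + 1 := ⟨N.card - 1, by have := h0.card_pos; omega⟩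
  have hN : TopTwo N.card (-∑ s ∈ N, s) (∏ s ∈ N, (X + C (-s))) := by
    rw [← Finset.sum_neg_distrib]
    exact TopTwo.prod N fun s => -s
  -- Subtracting the multiple of the node polynomial with the same top coefficient changes no value
  -- on `N`. The ratios being equal, the next coefficient vanishes too, and by Lagrange
  -- interpolation that coefficient is the sum in question.
  have hQ := h.add (hN.C_mul (-P.coeff N.card))
  set A := ∏ s ∈ N, (X + C (-s)) with hA
  set Q := P + C (-P.coeff N.card) * A with hQdef
  have hA1 : A.coeff N.card = 1 := by
    have h1 : A.Monic := monic_prod_of_monic _ _ fun s _ => monic_X_add_C _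
    have h2 : A.natDegree = N.card := by
      rw [hA, natDegree_prod_of_monic _ _ fun s _ => monic_X_add_C _]
      simp only [natDegree_X_add_C, Finset.sum_const, smul_eq_mul, mul_one]
    rw [← h2]; exact h1
  have hQ0 : Q.coeff N.card = 0 := by
    rw [hQdef, coeff_add, coeff_C_mul, hA1]; ring
  have hrel := hQ.2
  rw [coeff_reflect, coeff_reflect, revAt_le (by omega), revAt_le (by omega), Nat.sub_zero, hQ0,
    mul_zero] at hrel
  have hdeg : Q.degree < N.card := by
    rw [degree_lt_iff_coeff_zero]
    intro m hm
    rcases hm.eq_or_lt with rfl | hm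
    · exact hQ0
    · exact coeff_eq_zero_of_natDegree_lt (hQ.1.trans_lt hm)
  have := Lagrange.coeff_eq_sum (s := N) (v := id) Function.injective_id.injOn hdeg
  rw [hrel] at this
  rw [this]
  refine Finset.sum_congr rfl fun s hs => ?_
  have hs0 : A.eval s = 0 := by
    rw [hA, eval_prod]
    exact Finset.prod_eq_zero hs (by simp)
  simp [hQdef, hs0]

end TopTwo

/-! ### Recursive form of the weight functions -/

section Recursion

variable {F : Type*} [Field F] [DecidableEq F]

/-- The number of entries of `l` in `I` minus the number of entries not in `I`. -/
def wt {ι : Type*} [DecidableEq ι] (I : Finset ι) (l : List ι) : ℤ := 2 * (l.countP (· ∈ I) : ℤ) - l.length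

/-- A sum over orderings of `T`, computed by removing the entries of `l` one by one. -/
def shuffleSum (α γ g : F → F → F) (β : ℤ → F → F → F) (I : Finset F) :
    List F → Finset F → F
  | [], T => if T = ∅ then 1 else 0
  | a :: l, T =>
    if a ∈ I then
      -- Here s is the variable whose index is the node a. Later nodes contribute `γ s`; the unused
      -- variables b have later indices, hence contribute `α b a`, and each forms a pair `g s b`
      -- with s.
      ∑ s ∈ T, β (wt I l) s a * (l.map (γ s)).prod *
        (∏ b ∈ T.erase s, g s b * α b a) * shuffleSum α γ g β I l (T.erase s)
    else (∏ t ∈ T, α t a) * shuffleSum α γ g β I l T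

lemma shuffleSum_eq_zero (α γ g : F → F → F) (β : ℤ → F → F → F) (I : Finset F) (l : List F) :
    ∀ T : Finset F, T.card ≠ l.countP (· ∈ I) → shuffleSum α γ g β I l T = 0 := by
  induction l with
  | nil =>
    intro T hT
    have : T ≠ ∅ := by rintro rfl; simp at hT
    simp [shuffleSum, this]
  | cons a l ih =>
    intro T hT
    rw [shuffleSum]
    split_ifs with ha
    · refine Finset.sum_eq_zero fun s hs => ?_
      rw [ih, mul_zero]
      rw [List.countP_cons_of_pos (by simpa using ha)] at hT
      have := Finset.card_erase_add_one hs
      omega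
    · rw [ih, mul_zero]
      rwa [List.countP_cons_of_neg (by simpa using ha)] at hT

variable (la yy : F)

/-- The recursive form of the weight functions `W_I`. -/
def wPlus (I : Finset F) : List F → Finset F → F :=
  shuffleSum (fun t a => t - a + yy) (fun t a => t - a) (fun s b => (s - b + yy) / (s - b))
    (fun w s a => yy * (la + s - a - w * yy)) I

/-- The recursive form of the numerators of the functions `W̃⁻_I`. -/
def wMinus (I : Finset F) : List F → Finset F → F :=
  shuffleSum (fun t a => t - a) (fun t a => t - a + yy) (fun s b => (b - s + yy) / (b - s))
    (fun w s a => yy * (la + a - s - (w + 1) * yy)) I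

variable {la yy}

lemma wPlus_cons_of_mem {I : Finset F} {a : F} (ha : a ∈ I) (l : List F) (T : Finset F) :
    wPlus la yy I (a :: l) T = ∑ s ∈ T, yy * (la + s - a - wt I l * yy) *
      (l.map fun b => s - b).prod * (∏ b ∈ T.erase s, (s - b + yy) / (s - b) * (b - a + yy)) *
        wPlus la yy I l (T.erase s) := by
  rw [wPlus, shuffleSum, if_pos ha]

lemma wPlus_cons_of_notMem {I : Finset F} {a : F} (ha : a ∉ I) (l : List F) (T : Finset F) :
    wPlus la yy I (a :: l) T = (∏ t ∈ T, (t - a + yy)) * wPlus la yy I l T := by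
  rw [wPlus, shuffleSum, if_neg ha]

lemma wMinus_cons_of_mem {I : Finset F} {a : F} (ha : a ∈ I) (l : List F) (T : Finset F) :
    wMinus la yy I (a :: l) T = ∑ s ∈ T, yy * (la + a - s - (wt I l + 1) * yy) *
      (l.map fun b => s - b + yy).prod *
        (∏ b ∈ T.erase s, (b - s + yy) / (b - s) * (b - a)) * wMinus la yy I l (T.erase s) := by
  rw [wMinus, shuffleSum, if_pos ha]

lemma wMinus_cons_of_notMem {I : Finset F} {a : F} (ha : a ∉ I) (l : List F) (T : Finset F) :
    wMinus la yy I (a :: l) T = (∏ t ∈ T, (t - a)) * wMinus la yy I l T := by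
  rw [wMinus, shuffleSum, if_neg ha]

lemma wPlus_eq_zero {I T : Finset F} {l : List F} (h : T.card ≠ l.countP (· ∈ I)) :
    wPlus la yy I l T = 0 :=
  shuffleSum_eq_zero _ _ _ _ _ _ _ h

lemma wMinus_eq_zero {I T : Finset F} {l : List F} (h : T.card ≠ l.countP (· ∈ I)) :
    wMinus la yy I l T = 0 :=
  shuffleSum_eq_zero _ _ _ _ _ _ _ h

/-- The weight function vanishes where `t₁ = z_b` and `t₂ = z_b - y`. -/
lemma wPlus_eq_zero_of_sub_mem (hy : yy ≠ 0) (I : Finset F) (b : F) :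
    ∀ (l : List F) (T : Finset F), b ∈ l → b ∈ T → b - yy ∈ T → wPlus la yy I l T = 0 := by
  have hne : b - yy ≠ b := by simpa using hy
  intro l
  induction l with
  | nil => simp
  | cons a l ih =>
    intro T hb hT hT'
    by_cases ha : a ∈ I
    · rw [wPlus_cons_of_mem ha]
      refine Finset.sum_eq_zero fun s hs => ?_
      -- Some factor vanishes in every ordering: the cross factor if b - yy is used while b is
      -- unused; the factor of b - yy at the node b if that node is reached with b - yy unused; the
      -- product over later nodes if b is used before its node.
      by_cases hs' : s = b - yy
      · rw [Finset.prod_eq_zero (i := b) (by simp [hT, hs', hne.symm]) (by simp [hs'])]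
        ring
      by_cases hba : b = a
      · rw [Finset.prod_eq_zero (i := b - yy) (by simp [hT', Ne.symm hs']) (by simp [hba])]
        ring
      have hbl : b ∈ l := by simpa [hba] using hb
      by_cases hsb : s = b
      · rw [List.prod_eq_zero (l := l.map _) (List.mem_map.2 ⟨b, hbl, by simp [hsb]⟩)]
        ring
      · rw [ih _ hbl (by simp [hT, Ne.symm hsb]) (by simp [hT', Ne.symm hs']), mul_zero]
    · rw [wPlus_cons_of_notMem ha]
      by_cases hba : b = a
      · rw [Finset.prod_eq_zero hT' (by simp [hba]), zero_mul]
      · rw [ih T (by simpa [hba] using hb) hT hT', mul_zero]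

end Recursion

/-! ### Dependence on one variable and vanishing of the sum of residues. -/

section Recursion

open Polynomial

variable {F : Type*} [Field F] [DecidableEq F] {la yy : F}

/-- The dependence of the weight function on one of the variables `t`: after multiplication by
`∏ (t - b)` it is a polynomial with prescribed ratio of the two top coefficients. -/
lemma exists_polynomial_wPlus (la yy : F) (I : Finset F) :
    ∀ (l : List F) (K : Finset F), l.countP (· ∈ I) = K.card + 1 →
      ∃ P : F[X], TopTwo (l.length + K.card)
          (la - l.sum + ((l.length : F) - K.card - 1) * yy - ∑ b ∈ K, b) P ∧
        (∀ b ∈ K, P.eval b = 0) ∧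
        ∀ s, s ∉ K → P.eval s = (∏ b ∈ K, (s - b)) * wPlus la yy I l (insert s K) := by
  intro l
  induction l with
  | nil => intro K hK; simp at hK
  | cons a l ih =>
    intro K hK
    by_cases ha : a ∈ I
    · rw [List.countP_cons_of_pos (by simpa using ha)] at hK
      have hK' : l.countP (· ∈ I) = K.card := by omega
      have hex : ∀ κ ∈ K, ∃ P : F[X], TopTwo (l.length + (K.erase κ).card)
          (la - l.sum + ((l.length : F) - (K.erase κ).card - 1) * yy - ∑ b ∈ K.erase κ, b) P ∧
          (∀ b ∈ K.erase κ, P.eval b = 0) ∧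
          ∀ s, s ∉ K.erase κ →
            P.eval s = (∏ b ∈ K.erase κ, (s - b)) * wPlus la yy I l (insert s (K.erase κ)) :=
        fun κ hκ => ih _ (by rw [hK', Finset.card_erase_add_one hκ])
      choose! p hp1 hp2 hp3 using hex
      let c : F → F := fun s => yy * (la + s - a - wt I l * yy) * (l.map fun b => s - b).prod
      have hwt : (wt I l : F) = 2 * K.card - l.length := by
        rw [wt, hK']; push_cast; ring
      -- `A` collects the terms in which the free variable s is used at the node a, and `B κ` those
      -- in which κ ∈ K is; both are multiplied by ∏ (s - b). In `B κ` the factor s - κ clears the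
      -- denominator of the pair (κ, s) and leaves s - κ - yy.
      let A : F[X] := C (yy * (∏ b ∈ K, (b - a + yy)) * wPlus la yy I l K) *
        ((X + C (la - a - wt I l * yy)) * (l.map fun b => X + C (-b)).prod *
          ∏ b ∈ K, (X + C (yy - b)))
      let d : F → F := fun κ => c κ *
        ∏ b ∈ K.erase κ, ((κ - b + yy) / (κ - b) * (b - a + yy))
      let B : F → F[X] := fun κ => C (d κ) * ((X + C (-yy - κ)) * (X + C (yy - a)) * p κ)
      have hAe : ∀ s, A.eval s = c s * (∏ b ∈ K, (s - b + yy)) * (∏ b ∈ K, (b - a + yy)) *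
          wPlus la yy I l K := by
        intro s
        have h1 : eval s (l.map fun b => X + C (-b)).prod = (l.map fun b => s - b).prod := by
          rw [← coe_evalRingHom, map_list_prod, List.map_map]
          congr 2
          funext b
          simp [sub_eq_add_neg]
        have h2 : eval s (∏ b ∈ K, (X + C (yy - b))) = ∏ b ∈ K, (s - b + yy) := by
          rw [eval_prod]
          refine Finset.prod_congr rfl fun b _ => ?_
          simp only [eval_add, eval_X, eval_C]; ring
        simp only [A, c, eval_mul, eval_C, h1, h2, eval_add, eval_X]
        ring
      have hBe : ∀ κ s, (B κ).eval s = d κ * ((s - κ - yy) * (s - a + yy) * (p κ).eval s) := by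
        intro κ s
        simp only [B, eval_mul, eval_C, eval_add, eval_X]
        ring
      refine ⟨A + ∑ κ ∈ K, B κ, ?_, ?_, ?_⟩
      -- The leading coefficients of `A` and of the `B κ` are unrelated, but their ratios coincide.
      -- For `A` this rests on the dynamical shift: the weight at a equals 2|K| - |l|.
      · refine TopTwo.add ?_ (TopTwo.sum fun κ hκ => ?_)
        · have := ((((TopTwo.X_add (la - a - wt I l * yy)).mul
            (TopTwo.list_prod l fun b => -b)).mul
              (TopTwo.prod K fun b => yy - b))).C_mul
                (yy * (∏ b ∈ K, (b - a + yy)) * wPlus la yy I l K)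
          convert this using 1
          · simp; ring
          · have : (l.map fun b => -b).sum = - l.sum := (List.sum_neg l).symm
            have h2 : ∑ i ∈ K, (yy - i) = K.card * yy - ∑ i ∈ K, i := by
              rw [Finset.sum_sub_distrib]; simp
            simp only [List.length_cons, List.sum_cons, hwt, this, h2]
            push_cast
            ring
        · have := (((TopTwo.X_add (-yy - κ)).mul (TopTwo.X_add (yy - a))).mul
            (hp1 κ hκ)).C_mul (d κ)
          have hc := Finset.card_erase_add_one hκ
          convert this using 1
          · simp; omega
          · rw [← Finset.add_sum_erase K _ hκ, ← hc]
            simp only [List.length_cons, List.sum_cons]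
            push_cast
            ring
      · intro b hb
        -- The apparent pole at s = b cancels between `A` and `B b`; the other `B κ` vanish at b by
        -- induction.
        rw [eval_add, eval_finsetSum, Finset.sum_eq_single_of_mem b hb]
        · rw [hAe, hBe, hp3 b hb b (by simp), Finset.insert_erase hb]
          simp only [d]
          rw [Finset.prod_mul_distrib, Finset.prod_div_distrib]
          have h0 : ∏ x ∈ K.erase b, (b - x) ≠ 0 :=
            Finset.prod_ne_zero_iff.2 fun x hx => sub_ne_zero.2 (Finset.ne_of_mem_erase hx).symm
          rw [← Finset.mul_prod_erase K (fun x => b - x + yy) hb,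
            ← Finset.mul_prod_erase K (fun x => x - a + yy) hb]
          field_simp
          ring
        · intro κ hκ hne
          rw [hBe, hp2 κ hκ b (by simp [hb, hne.symm])]
          ring
      · intro s hs
        rw [wPlus_cons_of_mem ha, Finset.sum_insert hs, mul_add, eval_add, eval_finsetSum,
          Finset.mul_sum]
        congr 1
        · rw [hAe, Finset.erase_insert hs, Finset.prod_mul_distrib, Finset.prod_div_distrib]
          have h0 : ∏ x ∈ K, (s - x) ≠ 0 :=
            Finset.prod_ne_zero_iff.2 fun x hx => sub_ne_zero.2 fun h => hs (h ▸ hx)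
          simp only [c]
          field_simp
        · refine Finset.sum_congr rfl fun κ hκ => ?_
          have hsκ : s ≠ κ := fun h => hs (h ▸ hκ)
          have hs' : s ∉ K.erase κ := fun h => hs (Finset.mem_of_mem_erase h)
          rw [hBe, hp3 κ hκ s hs', Finset.erase_insert_of_ne hsκ, Finset.prod_insert hs',
            ← Finset.mul_prod_erase K (fun x => s - x) hκ]
          have h0 : κ - s ≠ 0 := sub_ne_zero.2 hsκ.symm
          simp only [d, c]
          field_simp
          ring
    · rw [List.countP_cons_of_neg (by simpa using ha)] at hK
      obtain ⟨P, h1, h2, h3⟩ := ih K hK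
      refine ⟨C (∏ b ∈ K, (b - a + yy)) * ((X + C (yy - a)) * P), ?_, ?_, ?_⟩
      · have := ((TopTwo.X_add (yy - a)).mul h1).C_mul (∏ b ∈ K, (b - a + yy))
        convert this using 1
        · simp; ring
        · simp only [List.length_cons, List.sum_cons]
          push_cast
          ring
      · intro b hb
        simp [h2 b hb]
      · intro s hs
        rw [wPlus_cons_of_notMem ha, Finset.prod_insert hs]
        simp only [eval_mul, eval_C, eval_add, eval_X, h3 s hs]
        ring

/-- The sum of the residues at the points `z_b`. -/
lemma sum_residues_wPlus (hy : yy ≠ 0) (I : Finset F) (l : List F) (x : F) (K : Finset F)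
    (hl : (x :: l).Nodup) (hg : ∀ a ∈ x :: l, ∀ b ∈ x :: l, a - b + yy ≠ 0)
    (hK : K ⊆ l.toFinset) (hc : l.countP (· ∈ I) = K.card + 1) (μ : F)
    (hμ : μ = la + x - (2 * K.card + 1 - l.length) * yy) :
    ∑ s ∈ (x :: l).toFinset \ K, (μ - s) * wPlus la yy I l (insert s K) /
      ((∏ b ∈ ((x :: l).toFinset \ K).erase s, (s - b)) * ∏ b ∈ K, (s - b + yy)) = 0 := by
  obtain ⟨P, h1, h2, h3⟩ := exists_polynomial_wPlus la yy I l K hc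
  set Z := (x :: l).toFinset with hZ
  have hKZ : K ⊆ Z := hK.trans (by rw [hZ, List.toFinset_cons]; exact Finset.subset_insert _ _)
  have hg' : ∀ a ∈ Z, ∀ b ∈ Z, a - b + yy ≠ 0 := by
    intro a ha b hb; exact hg a (by simpa [hZ] using ha) b (by simpa [hZ] using hb)
  have hZs : ∑ b ∈ Z, b = x + l.sum := by
    rw [hZ, List.sum_toFinset _ hl]; simp
  have hZc : Z.card = l.length + 1 := by
    rw [hZ, List.toFinset_card_of_nodup hl]; rfl
  -- These are the zeros of ∏ (s - b + yy). The nodes of the residue sum are Z ∪ K'; the numerator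
  -- vanishes on K by construction and on K' by `wPlus_eq_zero_of_sub_mem`, which leaves Z \ K.
  let K' : Finset F := K.image fun b => b - yy
  have hinj : Function.Injective fun b : F => b - yy := fun a b h => sub_left_injective h
  have hdisj : Disjoint Z K' := by
    rw [Finset.disjoint_left]
    intro a ha ha'
    obtain ⟨b, hb, rfl⟩ := Finset.mem_image.1 ha'
    exact hg' _ ha _ (hKZ hb) (by ring)
  have hcard : (Z ∪ K').card = l.length + K.card + 1 := by
    rw [Finset.card_union_of_disjoint hdisj, Finset.card_image_of_injective _ hinj, hZc]; ring
  have hsum : ∑ s ∈ Z ∪ K', s = x + l.sum + ∑ b ∈ K, b - K.card * yy := by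
    rw [Finset.sum_union hdisj, Finset.sum_image hinj.injOn, hZs, Finset.sum_sub_distrib]
    simp; ring
  -- The value of μ is the one for which the ratio equals minus the sum of the nodes, so that
  -- infinity contributes no residue.
  have htop : TopTwo (Z ∪ K').card (-∑ s ∈ Z ∪ K', s) ((X + C (-μ)) * P) := by
    convert (TopTwo.X_add (-μ)).mul h1 using 1
    · rw [hcard]; ring
    · rw [hsum, hμ]; ring
  have hne : (Z ∪ K').Nonempty := Finset.card_pos.1 (by omega)
  have hmain := htop.sum_div_eq_zero hne
  have hsub : Z \ K ⊆ Z ∪ K' := Finset.sdiff_subset.trans Finset.subset_union_left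
  rw [← Finset.sum_subset hsub] at hmain
  · rw [← neg_eq_zero, ← hmain, ← Finset.sum_neg_distrib]
    refine Finset.sum_congr rfl fun s hs => ?_
    obtain ⟨hsZ, hsK⟩ := Finset.mem_sdiff.1 hs
    have hsK' : s ∉ K' := Finset.disjoint_left.1 hdisj hsZ
    have hsplit : (Z ∪ K').erase s = ((Z \ K).erase s ∪ K) ∪ K' := by
      ext t
      simp only [Finset.mem_erase, Finset.mem_union, Finset.mem_sdiff]
      constructor
      · tauto
      · rintro ((⟨h, h', _⟩ | h) | h)
        · exact ⟨h, Or.inl h'⟩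
        · exact ⟨fun h' => hsK (h' ▸ h), Or.inl (hKZ h)⟩
        · exact ⟨fun h' => hsK' (h' ▸ h), Or.inr h⟩
    have hd1 : Disjoint ((Z \ K).erase s ∪ K) K' := by
      refine Finset.disjoint_of_subset_left ?_ hdisj
      exact Finset.union_subset ((Finset.erase_subset _ _).trans Finset.sdiff_subset) hKZ
    have hd2 : Disjoint ((Z \ K).erase s) K :=
      Finset.disjoint_of_subset_left (Finset.erase_subset _ _) Finset.sdiff_disjoint
    rw [hsplit, Finset.prod_union hd1, Finset.prod_union hd2, Finset.prod_image hinj.injOn]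
    have e1 : ∏ b ∈ K, (s - (b - yy)) = ∏ b ∈ K, (s - b + yy) :=
      Finset.prod_congr rfl fun b _ => by ring
    have n1 : ∏ b ∈ K, (s - b) ≠ 0 :=
      Finset.prod_ne_zero_iff.2 fun b hb => sub_ne_zero.2 fun h => hsK (h ▸ hb)
    have n2 : ∏ b ∈ K, (s - b + yy) ≠ 0 :=
      Finset.prod_ne_zero_iff.2 fun b hb => hg' _ hsZ _ (hKZ hb)
    have n3 : ∏ b ∈ (Z \ K).erase s, (s - b) ≠ 0 :=
      Finset.prod_ne_zero_iff.2 fun b hb => sub_ne_zero.2 (Finset.ne_of_mem_erase hb).symm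
    rw [e1, eval_mul, h3 s hsK]
    simp only [eval_add, eval_X, eval_C]
    field_simp
    ring
  · intro s hs hs'
    rw [eval_mul]
    by_cases hsK : s ∈ K
    · rw [h2 s hsK, mul_zero, zero_div]
    · have : s ∈ K' := by
        simp only [Finset.mem_union, Finset.mem_sdiff] at hs hs'
        tauto
      obtain ⟨b, hb, rfl⟩ := Finset.mem_image.1 this
      rw [h3 _ hsK, wPlus_eq_zero_of_sub_mem hy I b l _ (by simpa using hK hb) (by simp [hb])
        (by simp)]
      simp

end Recursion

/-! ### The pairing of plus and minus functions, by induction on the nodes. -/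

section Recursion

variable {F : Type*} [Field F] [DecidableEq F] {la yy : F}

/-- The denominators `R_K Q_K e_k²`. -/
def pairingDen (yy : F) (Z K : Finset F) : F :=
  (∏ a ∈ K, ((∏ b ∈ Z \ K, (a - b)) * ∏ b ∈ Z, (a - b + yy))) *
    ∏ a ∈ K, ∏ b ∈ K, (a - b + yy)

lemma pairingDen_insert_left {Z K : Finset F} {x : F} (hx : x ∉ Z) (hK : K ⊆ Z) :
    pairingDen yy (insert x Z) K =
      pairingDen yy Z K * ∏ c ∈ K, ((c - x) * (c - x + yy)) := by
  have hxK : x ∉ K := fun h => hx (hK h)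
  have h1 : insert x Z \ K = insert x (Z \ K) := Finset.insert_sdiff_of_notMem _ hxK
  have hx' : x ∉ Z \ K := fun h => hx (Finset.mem_sdiff.1 h).1
  simp only [pairingDen, h1, Finset.prod_insert hx, Finset.prod_insert hx', Finset.prod_mul_distrib]
  ring

/-- The product of b - s stands on the left because s leaves the complement of K, so these factors
of R_K disappear. -/
lemma pairingDen_insert_right {Z K : Finset F} {s : F} (hs : s ∈ Z) (hsK : s ∉ K) :
    pairingDen yy Z (insert s K) * ∏ b ∈ K, (b - s) =
      pairingDen yy Z K * (∏ b ∈ (Z \ K).erase s, (s - b)) * (∏ b ∈ Z, (s - b + yy)) * yy *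
        (∏ b ∈ K, (s - b + yy)) * ∏ b ∈ K, (b - s + yy) := by
  have h1 : Z \ insert s K = (Z \ K).erase s := by
    ext t; simp only [Finset.mem_sdiff, Finset.mem_insert, Finset.mem_erase]; tauto
  have h2 : ∏ a ∈ K, ∏ b ∈ Z \ K, (a - b) =
      (∏ b ∈ K, (b - s)) * ∏ a ∈ K, ∏ b ∈ (Z \ K).erase s, (a - b) := by
    rw [← Finset.prod_mul_distrib]
    exact Finset.prod_congr rfl fun a _ =>
      (Finset.mul_prod_erase (Z \ K) _ (Finset.mem_sdiff.2 ⟨hs, hsK⟩)).symm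
  simp only [pairingDen, h1, Finset.prod_insert hsK, Finset.prod_mul_distrib, h2]
  ring

/-- Exchanges "K, then s in K" for "K without s, then s", so that the inner sum runs over one moving
value with the others fixed, as a sum of residues requires. -/
lemma sum_powerset_sum_erase {ι M : Type*} [DecidableEq ι] [AddCommMonoid M] (Z : Finset ι)
    (h : ι → Finset ι → M) :
    ∑ K ∈ Z.powerset, ∑ s ∈ K, h s (K.erase s) = ∑ K ∈ Z.powerset, ∑ s ∈ Z \ K, h s K := by
  rw [Finset.sum_sigma', Finset.sum_sigma']
  refine Finset.sum_bij' (fun p _ => ⟨p.1.erase p.2, p.2⟩) (fun p _ => ⟨insert p.2 p.1, p.2⟩)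
    ?_ ?_ ?_ ?_ ?_
  · rintro ⟨K, s⟩ hp
    simp only [Finset.mem_sigma, Finset.mem_powerset, Finset.mem_sdiff] at hp ⊢
    exact ⟨(Finset.erase_subset _ _).trans hp.1, hp.1 hp.2, by simp⟩
  · rintro ⟨K, s⟩ hp
    simp only [Finset.mem_sigma, Finset.mem_powerset, Finset.mem_sdiff] at hp ⊢
    exact ⟨Finset.insert_subset hp.2.1 hp.1, by simp⟩
  · rintro ⟨K, s⟩ hp
    simp only [Finset.mem_sigma] at hp
    simp [Finset.insert_erase hp.2]
  · rintro ⟨K, s⟩ hp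
    simp only [Finset.mem_sigma, Finset.mem_sdiff] at hp
    simp [Finset.erase_insert hp.2.2]
  · rintro ⟨K, s⟩ _
    rfl

/-- The product of the values `d w(i, I)`, `i ∈ I`. -/
def weightProd (d : ℤ → F) (I : Finset F) : List F → F
  | [] => 1
  | a :: l => if a ∈ I then d (wt I l) * weightProd d I l else weightProd d I l

lemma wt_congr {ι : Type*} [DecidableEq ι] {I J : Finset ι} {l : List ι} (h : ∀ a ∈ l, (a ∈ I ↔ a ∈ J)) :
    wt I l = wt J l := by
  rw [wt, wt, List.countP_congr]
  simpa using h

/-- The summands of the pairing at a first entry in the second set only add up to zero. -/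
lemma pairing_eq_zero_of_notMem_of_mem (hy : yy ≠ 0) (I J : Finset F) (x : F) (l : List F)
    (hl : (x :: l).Nodup) (hg : ∀ a ∈ x :: l, ∀ b ∈ x :: l, a - b + yy ≠ 0) (hI : x ∉ I)
    (hJ : x ∈ J) :
    ∑ K ∈ (x :: l).toFinset.powerset, wPlus la yy I (x :: l) K * wMinus la yy J (x :: l) K /
      pairingDen yy (x :: l).toFinset K = 0 := by
  by_cases hc : (x :: l).countP (· ∈ I) = (x :: l).countP (· ∈ J)
  swap
  · refine Finset.sum_eq_zero fun K _ => ?_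
    by_cases h : K.card = (x :: l).countP (· ∈ I)
    · rw [wMinus_eq_zero (I := J) (h.trans_ne hc), mul_zero, zero_div]
    · rw [wPlus_eq_zero h, zero_mul, zero_div]
  rw [List.countP_cons_of_neg (by simpa using hI),
    List.countP_cons_of_pos (by simpa using hJ)] at hc
  obtain ⟨hxl, hl'⟩ := List.nodup_cons.1 hl
  have hxZ : x ∉ l.toFinset := by simpa using hxl
  have hZ : (x :: l).toFinset = insert x l.toFinset := List.toFinset_cons
  have hg' : ∀ a ∈ (x :: l).toFinset, ∀ b ∈ (x :: l).toFinset, a - b + yy ≠ 0 := by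
    intro a ha b hb; exact hg a (by simpa using ha) b (by simpa using hb)
  let h : F → Finset F → F := fun s K => wPlus la yy I (x :: l) (insert s K) *
    (yy * (la + x - s - (wt J l + 1) * yy) * (l.map fun b => s - b + yy).prod *
      (∏ b ∈ K, (b - s + yy) / (b - s) * (b - x)) * wMinus la yy J l K) /
        pairingDen yy (x :: l).toFinset (insert s K)
  have hsum : ∀ K ∈ (x :: l).toFinset.powerset,
      wPlus la yy I (x :: l) K * wMinus la yy J (x :: l) K / pairingDen yy (x :: l).toFinset K =
        ∑ s ∈ K, h s (K.erase s) := by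
    intro K _
    rw [wMinus_cons_of_mem hJ, Finset.mul_sum, Finset.sum_div]
    refine Finset.sum_congr rfl fun s hs => ?_
    simp only [h, Finset.insert_erase hs]
  rw [Finset.sum_congr rfl hsum, sum_powerset_sum_erase]
  refine Finset.sum_eq_zero fun K hK => ?_
  rw [Finset.mem_powerset] at hK
  by_cases hxK : x ∈ K
  · refine Finset.sum_eq_zero fun s _ => ?_
    simp only [h]
    rw [Finset.prod_eq_zero hxK (by simp)]
    simp
  by_cases hcK : K.card = l.countP (· ∈ J)
  swap
  · refine Finset.sum_eq_zero fun s _ => ?_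
    simp only [h]
    rw [wMinus_eq_zero (I := J) hcK]
    simp
  have hKl : K ⊆ l.toFinset := by
    rw [hZ] at hK
    exact (Finset.subset_insert_iff_of_notMem hxK).1 hK
  -- As wt J l = 2|K| - |l|, the linear factor of the minus function at x is yy (μ - s). Hence each
  -- summand is the corresponding residue times a factor independent of s.
  have hres := sum_residues_wPlus (la := la) hy I l x K hl hg hKl (by omega) _ rfl
  rw [← mul_zero ((∏ b ∈ K, (b - x + yy)) * (∏ b ∈ K, (b - x)) * wMinus la yy J l K /
    pairingDen yy (x :: l).toFinset K), ← hres, Finset.mul_sum]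
  refine Finset.sum_congr rfl fun s hs => ?_
  obtain ⟨hsZ, hsK⟩ := Finset.mem_sdiff.1 hs
  have hwt : (wt J l : F) = 2 * K.card - l.length := by
    rw [wt, ← hcK]; push_cast; ring
  have n1 : ∏ b ∈ K, (b - s) ≠ 0 :=
    Finset.prod_ne_zero_iff.2 fun b hb => sub_ne_zero.2 fun h => hsK (h ▸ hb)
  have n2 : ∏ b ∈ K, (s - b + yy) ≠ 0 :=
    Finset.prod_ne_zero_iff.2 fun b hb => hg' _ hsZ _ (hK hb)
  have n3 : ∏ b ∈ ((x :: l).toFinset \ K).erase s, (s - b) ≠ 0 :=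
    Finset.prod_ne_zero_iff.2 fun b hb => sub_ne_zero.2 (Finset.ne_of_mem_erase hb).symm
  have n4 : ∏ b ∈ K, (b - s + yy) ≠ 0 :=
    Finset.prod_ne_zero_iff.2 fun b hb => hg' _ (hK hb) _ hsZ
  have n5 : ∏ b ∈ l.toFinset, (s - b + yy) ≠ 0 :=
    Finset.prod_ne_zero_iff.2 fun b hb => hg' _ hsZ _ (by rw [hZ]; simp [hb])
  have n6 : s - x + yy ≠ 0 := hg' _ hsZ _ (by simp)
  have n7 : pairingDen yy (x :: l).toFinset K ≠ 0 := by
    refine mul_ne_zero (Finset.prod_ne_zero_iff.2 fun a ha => mul_ne_zero ?_ ?_) ?_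
    · exact Finset.prod_ne_zero_iff.2 fun b hb => sub_ne_zero.2 fun h =>
        (Finset.mem_sdiff.1 hb).2 (h ▸ ha)
    · exact Finset.prod_ne_zero_iff.2 fun b hb => hg' _ (hK ha) _ hb
    · exact Finset.prod_ne_zero_iff.2 fun a ha => Finset.prod_ne_zero_iff.2 fun b hb =>
        hg' _ (hK ha) _ (hK hb)
  have hden := pairingDen_insert_right (yy := yy) hsZ hsK
  have hden' : pairingDen yy (x :: l).toFinset (insert s K) =
      pairingDen yy (x :: l).toFinset K * (∏ b ∈ ((x :: l).toFinset \ K).erase s, (s - b)) *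
        ((s - x + yy) * ∏ b ∈ l.toFinset, (s - b + yy)) * yy *
        (∏ b ∈ K, (s - b + yy)) * (∏ b ∈ K, (b - s + yy)) / ∏ b ∈ K, (b - s) := by
    rw [eq_div_iff n1, hden]
    congr 4
    rw [hZ, Finset.prod_insert hxZ]
  simp only [h]
  rw [hden', wPlus_cons_of_notMem hI, Finset.prod_insert hsK, Finset.prod_mul_distrib,
    Finset.prod_div_distrib, ← List.prod_toFinset _ hl', hwt]
  generalize wPlus la yy I l (insert s K) = W1
  generalize wMinus la yy J l K = W2
  generalize pairingDen yy (x :: l).toFinset K = D at *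
  field_simp
  ring

/-- The orthogonality relations in recursive form. -/
lemma sum_wPlus_mul_wMinus (hy : yy ≠ 0) (I J : Finset F) :
    ∀ l : List F, l.Nodup → (∀ a ∈ l, ∀ b ∈ l, a - b + yy ≠ 0) →
      ∑ K ∈ l.toFinset.powerset,
        wPlus la yy I l K * wMinus la yy J l K / pairingDen yy l.toFinset K =
      if ∀ a ∈ l, (a ∈ I ↔ a ∈ J) then
        weightProd (fun w => (la - w * yy) * (la - (w + 1) * yy)) I l else 0 := by
  intro l
  induction l with
  | nil => simp [wPlus, wMinus, shuffleSum, pairingDen, weightProd]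
  | cons x l ih =>
    intro hl hg
    -- This is the only case that needs cancellation between different K.
    by_cases h4 : x ∉ I ∧ x ∈ J
    · rw [pairing_eq_zero_of_notMem_of_mem hy I J x l hl hg h4.1 h4.2, if_neg]
      intro h
      exact h4.1 ((h x (by simp)).2 h4.2)
    obtain ⟨hxl, hl'⟩ := List.nodup_cons.1 hl
    have hxZ : x ∉ l.toFinset := by simpa using hxl
    have hg' : ∀ a ∈ insert x l.toFinset, ∀ b ∈ insert x l.toFinset, a - b + yy ≠ 0 := by
      intro a ha b hb; exact hg a (by simpa using ha) b (by simpa using hb)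
    have ih' := ih hl' fun a ha b hb => hg a (by simp [ha]) b (by simp [hb])
    have hsub : ∀ {K}, K ∈ l.toFinset.powerset → ∀ {b}, b ∈ K → b ∈ l.toFinset :=
      fun hK _ hb => Finset.mem_powerset.1 hK hb
    have hxK : ∀ {K}, K ∈ l.toFinset.powerset → x ∉ K := fun hK h => hxZ (hsub hK h)
    have hn1 : ∀ {K}, K ∈ l.toFinset.powerset → ∏ b ∈ K, (b - x) ≠ 0 := fun hK =>
      Finset.prod_ne_zero_iff.2 fun b hb => sub_ne_zero.2 fun h => hxK hK (h ▸ hb)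
    have hn1' : ∀ {K}, K ∈ l.toFinset.powerset → ∏ b ∈ K, (x - b) ≠ 0 := fun hK =>
      Finset.prod_ne_zero_iff.2 fun b hb => sub_ne_zero.2 fun h => hxK hK (h ▸ hb)
    have hn2 : ∀ {K}, K ∈ l.toFinset.powerset → ∏ b ∈ K, (b - x + yy) ≠ 0 := fun hK =>
      Finset.prod_ne_zero_iff.2 fun b hb =>
        hg' _ (Finset.mem_insert_of_mem (hsub hK hb)) _ (Finset.mem_insert_self _ _)
    have hn3 : ∀ {K}, K ∈ l.toFinset.powerset → ∏ b ∈ K, (x - b + yy) ≠ 0 := fun hK =>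
      Finset.prod_ne_zero_iff.2 fun b hb =>
        hg' _ (Finset.mem_insert_self _ _) _ (Finset.mem_insert_of_mem (hsub hK hb))
    -- if `x ∈ I`, only the sets `K` containing `x` contribute
    have hplus0 : x ∈ I → ∀ K ∈ l.toFinset.powerset, wPlus la yy I (x :: l) K = 0 := by
      intro hI K hK
      rw [wPlus_cons_of_mem hI]
      refine Finset.sum_eq_zero fun s hs => ?_
      rw [List.prod_eq_zero (l := l.map _)
        (List.mem_map.2 ⟨s, by simpa using hsub hK hs, by simp⟩)]
      ring
    have hminus0 : x ∉ J → ∀ K, wMinus la yy J (x :: l) (insert x K) = 0 := by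
      intro hJ K
      rw [wMinus_cons_of_notMem hJ, Finset.prod_eq_zero (Finset.mem_insert_self x K) (by simp),
        zero_mul]
    rw [List.toFinset_cons, Finset.sum_powerset_insert hxZ]
    by_cases hI : x ∈ I
    · rw [Finset.sum_eq_zero fun K hK => by rw [hplus0 hI K hK, zero_mul, zero_div], zero_add]
      by_cases hJ : x ∈ J
      · have hiff : (∀ a ∈ x :: l, (a ∈ I ↔ a ∈ J)) ↔ ∀ a ∈ l, (a ∈ I ↔ a ∈ J) := by
          simp [hI, hJ]
        -- The value x has to be used at the node x: in the plus function any other s ∈ K is a later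
        -- node and kills the product over l, and in the minus function an unused x kills the
        -- product of b - x. At s = x the linear factors become yy (la - w yy) and yy (la - (w + 1)
        -- yy).
        have key : ∀ K ∈ l.toFinset.powerset,
            wPlus la yy I (x :: l) (insert x K) * wMinus la yy J (x :: l) (insert x K) /
              pairingDen yy (insert x l.toFinset) (insert x K) =
            (la - wt I l * yy) * (la - (wt J l + 1) * yy) *
              (wPlus la yy I l K * wMinus la yy J l K / pairingDen yy l.toFinset K) := by
          intro K hK
          have hx := hxK hK
          have hKs := Finset.mem_powerset.1 hK
          have e1 : wPlus la yy I (x :: l) (insert x K) =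
              yy * (la - wt I l * yy) * (∏ b ∈ l.toFinset, (x - b)) *
                ((∏ b ∈ K, (x - b + yy)) / (∏ b ∈ K, (x - b)) * ∏ b ∈ K, (b - x + yy)) *
                  wPlus la yy I l K := by
            rw [wPlus_cons_of_mem hI, Finset.sum_insert hx, Finset.sum_eq_zero, add_zero,
              Finset.erase_insert hx, Finset.prod_mul_distrib, Finset.prod_div_distrib,
              ← List.prod_toFinset _ hl']
            · ring
            · intro s hs
              rw [List.prod_eq_zero (l := l.map _)
                (List.mem_map.2 ⟨s, by simpa using hsub hK hs, by simp⟩)]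
              ring
          have e2 : wMinus la yy J (x :: l) (insert x K) =
              yy * (la - (wt J l + 1) * yy) * (∏ b ∈ l.toFinset, (x - b + yy)) *
                (∏ b ∈ K, (b - x + yy)) * wMinus la yy J l K := by
            rw [wMinus_cons_of_mem hJ, Finset.sum_insert hx, Finset.sum_eq_zero, add_zero,
              Finset.erase_insert hx, Finset.prod_mul_distrib, Finset.prod_div_distrib,
              ← List.prod_toFinset _ hl', div_mul_cancel₀ _ (hn1 hK)]
            · ring
            · intro s hs
              have hsx : x ≠ s := fun h => hx (h ▸ hs)
              rw [Finset.prod_eq_zero (i := x) (by simp [hsx]) (by simp)]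
              ring
          have hZK : (insert x l.toFinset \ K).erase x = l.toFinset \ K := by
            rw [Finset.insert_sdiff_of_notMem _ hx, Finset.erase_insert]
            simp [hxl]
          have e3 := pairingDen_insert_right (yy := yy) (Finset.mem_insert_self x l.toFinset) hx
          rw [hZK, Finset.prod_insert hxZ, pairingDen_insert_left hxZ hKs,
            Finset.prod_mul_distrib] at e3
          have e3' : pairingDen yy (insert x l.toFinset) (insert x K) =
              pairingDen yy l.toFinset K * (∏ b ∈ K, (b - x + yy)) *
                (∏ b ∈ l.toFinset \ K, (x - b)) * (yy * ∏ b ∈ l.toFinset, (x - b + yy)) * yy *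
                (∏ b ∈ K, (x - b + yy)) * ∏ b ∈ K, (b - x + yy) := by
            refine mul_right_cancel₀ (hn1 hK) ?_
            rw [e3]
            ring
          have e4 : ∏ b ∈ l.toFinset, (x - b) =
              (∏ b ∈ l.toFinset \ K, (x - b)) * ∏ b ∈ K, (x - b) :=
            (Finset.prod_sdiff hKs).symm
          have n1 := hn1' hK
          have n2 := hn2 hK
          have n3 := hn3 hK
          have n4 := hn3 (Finset.mem_powerset_self l.toFinset)
          have n5 : ∏ b ∈ l.toFinset \ K, (x - b) ≠ 0 :=
            hn1' (Finset.mem_powerset.2 Finset.sdiff_subset)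
          rw [e1, e2, e3', e4]
          generalize wPlus la yy I l K = W1
          generalize wMinus la yy J l K = W2
          generalize pairingDen yy l.toFinset K = D
          field_simp
        rw [Finset.sum_congr rfl key, ← Finset.mul_sum, ih']
        simp only [hiff]
        split_ifs with h
        · rw [weightProd, if_pos hI, wt_congr h]
        · rw [mul_zero]
      · rw [Finset.sum_eq_zero fun K _ => by rw [hminus0 hJ K, mul_zero, zero_div], if_neg]
        intro h
        exact hJ ((h x (by simp)).1 hI)
    · have hJ : x ∉ J := fun h => h4 ⟨hI, h⟩
      have hiff : (∀ a ∈ x :: l, (a ∈ I ↔ a ∈ J)) ↔ ∀ a ∈ l, (a ∈ I ↔ a ∈ J) := by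
        simp [hI, hJ]
      rw [Finset.sum_eq_zero (s := l.toFinset.powerset)
        (f := fun K => _ / pairingDen yy (insert x l.toFinset) (insert x K)) fun K _ => by
          rw [hminus0 hJ K, mul_zero, zero_div], add_zero]
      simp only [hiff]
      rw [weightProd, if_neg hI, ← ih']
      refine Finset.sum_congr rfl fun K hK => ?_
      rw [wPlus_cons_of_notMem hI, wMinus_cons_of_notMem hJ,
        pairingDen_insert_left hxZ (Finset.mem_powerset.1 hK), Finset.prod_mul_distrib]
      have n1 := hn1 hK
      have n2 := hn2 hK
      field_simp

end Recursion

/-! ### Symmetrizations as recursive sums. -/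

section SymSum

variable {F : Type*} [Field F] {k : ℕ}

/-- The symmetrization of `∏ φ_r(t_r) ∏_{a < b} g(t_a, t_b)`. -/
def symSum (φ : Fin k → F → F) (g : F → F → F) (t : Fin k → F) : F :=
  ∑ σ : Equiv.Perm (Fin k),
    (∏ r, φ r (t (σ r))) * ∏ a, ∏ b ∈ Finset.Ioi a, g (t (σ a)) (t (σ b))

/-- A permutation amounts to the choice p of the variable in first position and a permutation of the
others, which the transposition of 0 and p enumerates. -/
lemma symSum_succ (φ : Fin (k + 1) → F → F) (g : F → F → F) (t : Fin (k + 1) → F) :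
    symSum φ g t = ∑ p, φ 0 (t p) * (∏ r : Fin k, g (t p) (t (Equiv.swap 0 p r.succ))) *
      symSum (fun r => φ r.succ) g fun r => t (Equiv.swap 0 p r.succ) := by
  rw [symSum, ← Equiv.sum_comp Equiv.Perm.decomposeFin.symm, Fintype.sum_prod_type]
  refine Finset.sum_congr rfl fun p _ => ?_
  rw [symSum, Finset.mul_sum]
  refine Finset.sum_congr rfl fun σ _ => ?_
  simp only [Fin.prod_univ_succ, Fin.prod_Ioi_zero, Fin.prod_Ioi_succ,
    Equiv.Perm.decomposeFin_symm_apply_zero, Equiv.Perm.decomposeFin_symm_apply_succ]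
  rw [Equiv.prod_comp σ fun r : Fin k => g (t p) (t (Equiv.swap 0 p r.succ))]
  ring

lemma symSum_mul (h : F → F) (φ : Fin k → F → F) (g : F → F → F) (t : Fin k → F) :
    symSum (fun r x => h x * φ r x) g t = (∏ r, h (t r)) * symSum φ g t := by
  rw [symSum, symSum, Finset.mul_sum]
  refine Finset.sum_congr rfl fun σ _ => ?_
  rw [Finset.prod_mul_distrib, Equiv.prod_comp σ fun r => h (t r), mul_assoc]

variable [DecidableEq F]

lemma wt_ofFn {ι : Type*} [DecidableEq ι] {n : ℕ} (J : Finset ι) (zz : Fin n → ι) :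
    wt J (List.ofFn zz) = ∑ i, if zz i ∈ J then 1 else -1 := by
  induction n with
  | zero => simp [wt]
  | succ n ih =>
    rw [Fin.sum_univ_succ, ← ih fun i => zz i.succ, List.ofFn_succ, wt, wt, List.countP_cons,
      List.length_cons]
    split_ifs with h1 h2 h2
    · push_cast; ring
    · simp [h2] at h1
    · simp [h2] at h1
    · push_cast; ring

/-- Induction on the nodes. If node 0 is the index of a variable, it is that of the first one, and
`symSum_succ` peels that variable off; otherwise node 0 precedes every index and gives the same
factor `α` for all variables, which leaves the symmetrization. -/
lemma symSum_eq_shuffleSum (α γ g : F → F → F) (β : ℤ → F → F → F) (J : Finset F) (n : ℕ) :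
    ∀ (k : ℕ) (zz : Fin n → F) (e : Fin k → Fin n) (t : Fin k → F), StrictMono e →
      Function.Injective t → (∀ i, zz i ∈ J ↔ ∃ r, e r = i) →
      symSum (fun r x => ∏ a, if a < e r then α x (zz a) else if a = e r then
          β (∑ j ∈ Finset.Ioi (e r), if zz j ∈ J then 1 else -1) x (zz a) else γ x (zz a)) g t =
        shuffleSum α γ g β J (List.ofFn zz) (Finset.univ.image t) := by
  induction n with
  | zero =>
    intro k zz e t _ _ _
    obtain rfl : k = 0 := by
      by_contra hk
      exact (e ⟨0, Nat.pos_of_ne_zero hk⟩).elim0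
    simp [symSum, shuffleSum]
  | succ n ih =>
    intro k zz e t he ht hJ
    have hsucc : ∀ (i : Fin n), (∑ j ∈ Finset.Ioi i.succ, if zz j ∈ J then (1 : ℤ) else -1) =
        ∑ j ∈ Finset.Ioi i, if zz j.succ ∈ J then 1 else -1 := fun i =>
      Fin.sum_Ioi_succ (fun j => if zz j ∈ J then (1 : ℤ) else -1) i
    rw [List.ofFn_succ, shuffleSum]
    by_cases h0 : zz 0 ∈ J
    · rw [if_pos h0]
      obtain ⟨r0, hr0⟩ := (hJ 0).1 h0
      obtain ⟨k, rfl⟩ : ∃ k', k = k' + 1 := ⟨k - 1, by have := r0.pos; omega⟩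
      have he0 : e 0 = 0 := le_antisymm (hr0 ▸ he.monotone (Fin.zero_le r0)) (Fin.zero_le _)
      have hex : ∀ r : Fin k, ∃ i : Fin n, i.succ = e r.succ := fun r =>
        Fin.exists_succ_eq.2 fun h => by
          have := he (Fin.succ_pos r)
          rw [h] at this
          exact absurd this (Fin.not_lt_zero _)
      choose e' he' using hex
      have he'm : StrictMono e' := fun a b hab => by
        rw [← Fin.succ_lt_succ_iff, he', he']
        exact he (Fin.succ_lt_succ_iff.2 hab)
      have hJ' : ∀ i : Fin n, zz i.succ ∈ J ↔ ∃ r, e' r = i := by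
        intro i
        rw [hJ]
        constructor
        · rintro ⟨r, hr⟩
          obtain ⟨r', rfl⟩ : ∃ r', Fin.succ r' = r := Fin.exists_succ_eq.2 (by
            rintro rfl
            rw [he0] at hr
            exact Fin.succ_ne_zero _ hr.symm)
          exact ⟨r', Fin.succ_injective _ ((he' r').trans hr)⟩
        · rintro ⟨r, rfl⟩
          exact ⟨r.succ, (he' r).symm⟩
      rw [symSum_succ, Finset.sum_image ht.injOn]
      refine Finset.sum_congr rfl fun p _ => ?_
      have ht' : Function.Injective fun r : Fin k => t (Equiv.swap 0 p r.succ) :=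
        ht.comp ((Equiv.injective _).comp (Fin.succ_injective _))
      have himg : (Finset.univ.image t).erase (t p) =
          Finset.univ.image fun r : Fin k => t (Equiv.swap 0 p r.succ) := by
        have : (Finset.univ : Finset (Fin (k + 1))) =
            Finset.univ.image (Equiv.swap (0 : Fin (k + 1)) p) := by
          rw [Finset.image_univ_equiv]
        rw [this, Finset.image_image, Fin.univ_succ, Finset.cons_eq_insert, Finset.image_insert]
        simp only [Function.comp, Equiv.swap_apply_left, Finset.map_eq_image,
          Finset.image_image]
        rw [Finset.erase_insert]
        · rfl
        · simp only [Finset.mem_image, not_exists, not_and]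
          intro r _ h
          have h2 := ht h
          rw [← Equiv.swap_apply_left 0 p] at h2
          exact Fin.succ_ne_zero r ((Equiv.swap 0 p).injective (by simpa using h2))
      have hφ0 : (∏ a, if a < e 0 then α (t p) (zz a) else if a = e 0 then
          β (∑ j ∈ Finset.Ioi (e 0), if zz j ∈ J then 1 else -1) (t p) (zz a)
            else γ (t p) (zz a)) =
          β (wt J (List.ofFn fun i => zz i.succ)) (t p) (zz 0) *
            ((List.ofFn fun i => zz i.succ).map (γ (t p))).prod := by
        rw [he0, Fin.prod_univ_succ, Fin.sum_Ioi_zero (f := fun j => if zz j ∈ J then (1 : ℤ) else -1),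
          wt_ofFn, List.map_ofFn, List.prod_ofFn]
        simp [Fin.succ_ne_zero]
      have hφs : (fun (r : Fin k) x => ∏ a, if a < e r.succ then α x (zz a) else
          if a = e r.succ then β (∑ j ∈ Finset.Ioi (e r.succ), if zz j ∈ J then 1 else -1) x (zz a)
            else γ x (zz a)) =
          fun (r : Fin k) x => α x (zz 0) * ∏ a, if a < e' r then α x (zz a.succ) else
          if a = e' r then β (∑ j ∈ Finset.Ioi (e' r), if zz j.succ ∈ J then 1 else -1) x
            (zz a.succ) else γ x (zz a.succ) := by
        funext r x
        rw [Fin.prod_univ_succ, ← he', hsucc]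
        simp
      rw [hφ0, hφs, symSum_mul (fun x => α x (zz 0)),
        ih k (fun i => zz i.succ) e' _ he'm ht' hJ', himg, Finset.prod_image ht'.injOn,
        Finset.prod_mul_distrib]
      ring
    · rw [if_neg h0]
      have hex : ∀ r : Fin k, ∃ i : Fin n, i.succ = e r := fun r =>
        Fin.exists_succ_eq.2 fun h => h0 ((hJ 0).2 ⟨r, h⟩)
      choose e' he' using hex
      have he'm : StrictMono e' := fun a b hab => by
        rw [← Fin.succ_lt_succ_iff, he', he']
        exact he hab
      have hJ' : ∀ i : Fin n, zz i.succ ∈ J ↔ ∃ r, e' r = i := by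
        intro i
        rw [hJ]
        exact exists_congr fun r => by rw [← he', Fin.succ_inj]
      have hφs : (fun (r : Fin k) x => ∏ a, if a < e r then α x (zz a) else
          if a = e r then β (∑ j ∈ Finset.Ioi (e r), if zz j ∈ J then 1 else -1) x (zz a)
            else γ x (zz a)) =
          fun (r : Fin k) x => α x (zz 0) * ∏ a, if a < e' r then α x (zz a.succ) else
          if a = e' r then β (∑ j ∈ Finset.Ioi (e' r), if zz j.succ ∈ J then 1 else -1) x
            (zz a.succ) else γ x (zz a.succ) := by
        funext r x
        rw [Fin.prod_univ_succ, ← he', hsucc]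
        simp
      rw [hφs, symSum_mul (fun x => α x (zz 0)),
        ih k (fun i => zz i.succ) e' _ he'm ht hJ', Finset.prod_image ht.injOn]

lemma prod_weightProd (d : ℤ → F) (J : Finset F) (n : ℕ) :
    ∀ zz : Fin n → F, ∏ i ∈ Finset.univ.filter (fun i => zz i ∈ J),
        d (∑ j ∈ Finset.Ioi i, if zz j ∈ J then 1 else -1) =
      weightProd d J (List.ofFn zz) := by
  induction n with
  | zero => intro zz; simp [weightProd]
  | succ n ih =>
    intro zz
    rw [List.ofFn_succ, weightProd, Finset.prod_filter, Fin.prod_univ_succ,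
      Fin.sum_Ioi_zero (f := fun j => if zz j ∈ J then (1 : ℤ) else -1), ← ih, wt_ofFn,
      Finset.prod_filter]
    simp only [Fin.sum_Ioi_succ fun j => if zz j ∈ J then (1 : ℤ) else -1]
    split_ifs <;> simp

end SymSum

/-! ### The weight functions in recursive form. -/

section Bridge

variable {n k : ℕ}

lemma w_eq_sum (i : Fin n) (I : II n k) :
    w i I = ∑ j ∈ Finset.Ioi i, if j ∈ I.1 then 1 else -1 := by
  rw [w, Finset.sum_ite]
  have h1 : (Finset.univ.filter fun j => i < j ∧ j ∈ I.1) =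
      (Finset.Ioi i).filter fun j => j ∈ I.1 := by ext; simp
  have h2 : (Finset.univ.filter fun j => i < j ∧ j ∉ I.1) =
      (Finset.Ioi i).filter fun j => j ∉ I.1 := by ext; simp
  rw [h1, h2]
  simp
  ring

lemma mem_act_rev (I : II n k) (j : Fin n) :
    j ∈ (act Fin.revPerm⁻¹ I).1 ↔ Fin.rev j ∈ I.1 := by
  simp only [act, Finset.mem_map]
  constructor
  · rintro ⟨i, hi, rfl⟩
    simpa [Equiv.Perm.inv_def] using hi
  · intro h
    exact ⟨_, h, by simp [Equiv.Perm.inv_def]⟩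

/-- Reversal turns the positions after i into those before i, so the two weights together sum the
signs over all j ≠ i: the total 2k - n less the sign 1 of i. This explains the shift by (n - 2k) y
in W̃⁻. -/
lemma w_rev_add (I : II n k) {i : Fin n} (hi : i ∈ I.1) :
    w (Fin.rev i) (act Fin.revPerm⁻¹ I) + w i I = 2 * k - n - 1 := by
  have h1 : w (Fin.rev i) (act Fin.revPerm⁻¹ I) =
      ∑ j ∈ Finset.Iio i, if j ∈ I.1 then 1 else -1 := by
    rw [w_eq_sum]
    refine Finset.sum_equiv Fin.revPerm (fun j => ?_) fun j _ => ?_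
    · simp [Fin.rev_lt_iff]
    · simp [mem_act_rev]
  have h2 : ∑ j : Fin n, (if j ∈ I.1 then (1 : ℤ) else -1) = 2 * k - n := by
    have h3 : ∀ j : Fin n, (if j ∈ I.1 then (1 : ℤ) else -1) = 2 * (if j ∈ I.1 then 1 else 0) - 1 := by
      intro j; split_ifs <;> norm_num
    simp only [h3, Finset.sum_sub_distrib, ← Finset.mul_sum]
    simp [I.2]
  have h4 : (Finset.univ : Finset (Fin n)) = insert i (Finset.Iio i ∪ Finset.Ioi i) := by
    ext j; simp; omega
  rw [h4, Finset.sum_insert (by simp), Finset.sum_union, if_pos hi] at h2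
  · rw [h1, w_eq_sum]; linarith
  · rw [Finset.disjoint_left]; intro a; simp; omega

lemma elt_strictMono (I : II n k) : StrictMono (elt I) :=
  (I.1.orderEmbOfFin I.2).strictMono

lemma elt_mem (I : II n k) (r : Fin k) : elt I r ∈ I.1 :=
  Finset.orderEmbOfFin_mem _ _ _

lemma exists_elt_eq (I : II n k) (i : Fin n) : (∃ r, elt I r = i) ↔ i ∈ I.1 := by
  have := Finset.range_orderEmbOfFin I.1 I.2
  exact (Set.ext_iff.1 this i)

lemma elt_act_rev (I : II n k) (r : Fin k) :
    elt (act Fin.revPerm⁻¹ I) r = Fin.rev (elt I (Fin.rev r)) := by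
  have := Finset.orderEmbOfFin_unique (act Fin.revPerm⁻¹ I).2
    (f := fun r => Fin.rev (elt I (Fin.rev r)))
    (fun r => by rw [mem_act_rev, Fin.rev_rev]; exact elt_mem _ _)
    (fun a b hab => Fin.rev_lt_rev.2 (elt_strictMono I (Fin.rev_lt_rev.2 hab)))
  exact (congrFun this r).symm

lemma mem_image_iff_elt {ι : Type*} [DecidableEq ι] {zz : Fin n → ι} (hz : Function.Injective zz) (I : II n k) (i : Fin n) :
    zz i ∈ I.1.image zz ↔ ∃ r, elt I r = i := by
  rw [exists_elt_eq, hz.mem_finset_image]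

lemma sum_Ioi_image {ι : Type*} [DecidableEq ι] {zz : Fin n → ι} (hz : Function.Injective zz) (I : II n k) (i : Fin n) :
    (∑ j ∈ Finset.Ioi i, if zz j ∈ I.1.image zz then (1 : ℤ) else -1) = w i I := by
  simp only [w_eq_sum, hz.mem_finset_image]

variable {F : Type*} [Field F] [DecidableEq F]

lemma W_eq_wPlus (I : II n k) (la yy : F) {t : Fin k → F} {zz : Fin n → F}
    (ht : Function.Injective t) (hz : Function.Injective zz) :
    W I la t zz yy =
      wPlus la yy (I.1.image zz) (List.ofFn zz) (Finset.univ.image t) := by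
  rw [wPlus, ← symSum_eq_shuffleSum _ _ _ _ _ n k zz (elt I) t (elt_strictMono I) ht
    (mem_image_iff_elt hz I), W, symSum, Finset.mul_sum]
  refine Finset.sum_congr rfl fun σ _ => ?_
  rw [weightTerm, ← mul_assoc]
  congr 1
  · have h : (yy ^ k : F) = ∏ _ : Fin k, yy := by simp
    rw [h, ← Finset.prod_mul_distrib]
    refine Finset.prod_congr rfl fun r _ => ?_
    -- The power yy ^ k provides one factor per variable, placed at the index of that variable,
    -- where `β` contains it.
    have h2 : yy = ∏ a : Fin n, if a = elt I r then yy else 1 := by simp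
    nth_rewrite 1 [h2]
    rw [← Finset.prod_mul_distrib]
    refine Finset.prod_congr rfl fun a _ => ?_
    rw [lFactor, sum_Ioi_image hz]
    by_cases h3 : a = elt I r
    · simp [h3]
    · simp [h3]
  · simp only [Ring.inverse_eq_inv', div_eq_mul_inv]

lemma Wσ_rev_eq_wMinus (I : II n k) (la yy : F) {t : Fin k → F} {zz : Fin n → F}
    (ht : Function.Injective t) (hz : Function.Injective zz) :
    (-1) ^ k * Wσ Fin.revPerm I (-la - (((n : ℤ) - 2 * (k : ℤ) : ℤ) : F) * yy) t zz yy =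
      wMinus la yy (I.1.image zz) (List.ofFn zz) (Finset.univ.image t) := by
  -- Reversing the order of the variables undoes the reversed enumeration of I and exchanges the
  -- members of each pair, which gives the `g` of `wMinus`. The sign (-1) ^ k enters the linear
  -- factors, and `w_rev_add` brings them to the form of `β`.
  rw [wMinus, ← symSum_eq_shuffleSum _ _ _ _ _ n k zz (elt I) t (elt_strictMono I) ht
    (mem_image_iff_elt hz I), Wσ, W, symSum, ← mul_assoc, Finset.mul_sum,
    ← Equiv.sum_comp (Equiv.mulRight Fin.revPerm)]
  refine Finset.sum_congr rfl fun σ _ => ?_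
  rw [weightTerm, ← mul_assoc]
  congr 1
  · have h : ((-1) ^ k * yy ^ k : F) = ∏ _ : Fin k, (-yy) := by simp [← mul_pow]
    rw [h, ← Finset.prod_mul_distrib, ← Equiv.prod_comp Fin.revPerm]
    refine Finset.prod_congr rfl fun r _ => ?_
    have h2 : -yy = ∏ a : Fin n, if a = elt I r then -yy else 1 := by simp
    rw [h2, ← Equiv.prod_comp Fin.revPerm fun a => lFactor _ _ _ _ _ _ a,
      ← Finset.prod_mul_distrib]
    refine Finset.prod_congr rfl fun a _ => ?_
    have hw : w (Fin.rev (elt I r)) (act Fin.revPerm⁻¹ I) = 2 * k - n - 1 - w (elt I r) I := by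
      rw [← w_rev_add I (elt_mem I r)]; ring
    rw [lFactor, sum_Ioi_image hz, elt_act_rev]
    simp only [Fin.revPerm_apply, Fin.rev_rev, Fin.rev_lt_rev, Fin.rev_inj, Equiv.coe_mulRight,
      Equiv.Perm.mul_apply, hw]
    rcases lt_trichotomy a (elt I r) with h3 | h3 | h3
    · simp [h3, h3.ne, h3.not_gt]
    · simp only [h3, lt_irrefl, if_false, if_true]
      push_cast
      ring
    · simp [h3, h3.ne', h3.not_gt]
  · simp only [Ring.inverse_eq_inv', ← div_eq_mul_inv, Equiv.coe_mulRight, Equiv.Perm.mul_apply]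
    have hI : ∀ (f : Fin k → Fin k → F), ∏ a, ∏ b ∈ Finset.Ioi a, f a b =
        ∏ a, ∏ b, if a < b then f a b else 1 := by
      intro f
      refine Finset.prod_congr rfl fun a _ => ?_
      rw [← Finset.prod_filter]
      congr 1
      ext; simp
    rw [hI, hI, Finset.prod_comm, ← Equiv.prod_comp Fin.revPerm]
    refine Finset.prod_congr rfl fun a _ => ?_
    rw [← Equiv.prod_comp Fin.revPerm]
    refine Finset.prod_congr rfl fun b _ => ?_
    simp [Fin.rev_lt_rev]

end Bridge

/-! ### Passage to the fraction field. -/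

section Domain

variable {n : ℕ}

lemma denominators_le_nonZeroDivisors (n : ℕ) :
    denominators n ≤ nonZeroDivisors (Polynomial (P n)) := by
  rw [denominators, Submonoid.closure_le]
  have hX : ∀ a b : Fin n ⊕ Unit, a ≠ b → (MvPolynomial.X a - MvPolynomial.X b : P n) ≠ 0 :=
    fun a b hab h => hab (MvPolynomial.X_injective (sub_eq_zero.1 h))
  rintro p ((⟨i, j, hij, rfl⟩ | ⟨i, j, rfl⟩) | ⟨l, rfl⟩)
  · refine mem_nonZeroDivisors_of_ne_zero (Polynomial.C_ne_zero.2 (hX _ _ ?_))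
    simpa using hij
  · refine mem_nonZeroDivisors_of_ne_zero (Polynomial.C_ne_zero.2 fun h => ?_)
    have := congrArg (MvPolynomial.eval (Sum.elim (fun _ => (0 : ℂ)) fun _ => 1)) h
    simp [zP, yP] at this
  · exact mem_nonZeroDivisors_of_ne_zero (Polynomial.monic_X_add_C _).ne_zero

instance instIsDomainL (n : ℕ) : IsDomain (L n) :=
  IsLocalization.isDomain_of_le_nonZeroDivisors (L n)
    (denominators_le_nonZeroDivisors n)

lemma z_injective (n : ℕ) : Function.Injective (z : Fin n → L n) := by
  intro a b h
  by_contra hab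
  exact (isUnit_sub hab).ne_zero (sub_eq_zero.2 h)

/-- An index makes z_i - z_i - y an admissible denominator, so y is even a unit. -/
lemma y_ne_zero (i : Fin n) : y n ≠ 0 := by
  simpa using (isUnit_sub_add i i).ne_zero

end Domain

section Map

variable {A B : Type*} [CommRing A] [CommRing B] (f : A →+* B) {n k : ℕ}

lemma map_inverse_of_isUnit {a : A} (ha : IsUnit a) :
    f (Ring.inverse a) = Ring.inverse (f a) := by
  obtain ⟨u, rfl⟩ := ha
  rw [Ring.inverse_unit]
  exact (Ring.inverse_unit (Units.map (f : A →* B) u)).symm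

/-- `Ring.inverse` is compatible with a homomorphism at units, hence the condition on the
differences. -/
lemma map_W (I : II n k) (la : A) (t : Fin k → A) (zz : Fin n → A) (yy : A)
    (ht : ∀ a b, a ≠ b → IsUnit (t a - t b)) :
    f (W I la t zz yy) = W I (f la) (fun r => f (t r)) (fun a => f (zz a)) (f yy) := by
  rw [W, W, map_mul, map_pow, map_sum]
  congr 1
  refine Finset.sum_congr rfl fun σ _ => ?_
  simp only [weightTerm, map_mul, map_prod, lFactor, apply_ite f, map_add, map_sub, map_intCast]
  congr 1
  refine Finset.prod_congr rfl fun a _ => Finset.prod_congr rfl fun b hb => ?_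
  rw [map_inverse_of_isUnit f (ht _ _ fun h => (Finset.mem_Ioi.1 hb).ne (σ.injective h)), map_sub]

end Map

/-! ### Orthogonality of the weight functions over 𝓛. -/

section Orthogonality

variable {n k : ℕ}

lemma act_one_inv (I : II n k) : act (1 : Equiv.Perm (Fin n))⁻¹ I = I := by
  rw [inv_one]
  refine Subtype.ext ?_
  ext i
  simp only [act, Finset.mem_map_equiv]
  rfl

lemma image_elt (I : II n k) : Finset.univ.image (elt I) = I.1 := by
  ext i
  simpa using exists_elt_eq I i

lemma C_one (r : ℤ) (I : II n k) {A : Type*} [CommRing A] (la yy : A) :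
    Cσ r 1 I la yy = ∏ i ∈ I.1, (la - ((w i I + r : ℤ) : A) * yy) := by
  rw [Cσ, act_one_inv]
  rfl

lemma zAt_injective (K : II n k) : Function.Injective (zAt K) :=
  (z_injective n).comp (elt_strictMono K).injective

lemma pairingDen_image {F : Type*} [Field F] [DecidableEq F] {zz : Fin n → F}
    (hz : Function.Injective zz) (yy : F) (K : II n k) :
    pairingDen yy (Finset.univ.image zz) (K.1.image zz) =
      (∏ a ∈ K.1, ∏ b ∈ K.1ᶜ, (zz a - zz b)) * (∏ a ∈ K.1, ∏ b ∈ K.1ᶜ, (zz a - zz b + yy)) *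
        (e (fun r => zz (elt K r)) yy * e (fun r => zz (elt K r)) yy) := by
  have h1 : Finset.univ.image zz \ K.1.image zz = K.1ᶜ.image zz := by
    rw [← Finset.image_sdiff _ _ hz, Finset.compl_eq_univ_sdiff]
  have h2 : e (fun r => zz (elt K r)) yy = ∏ a ∈ K.1, ∏ b ∈ K.1, (zz a - zz b + yy) := by
    rw [e, ← prod_elt K fun a => ∏ b ∈ K.1, (zz a - zz b + yy)]
    exact Finset.prod_congr rfl fun r _ => prod_elt K fun b => zz (elt K r) - zz b + yy
  have h3 : ∀ a, ∏ b, (zz a - zz b + yy) =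
      (∏ b ∈ K.1, (zz a - zz b + yy)) * ∏ b ∈ K.1ᶜ, (zz a - zz b + yy) := fun a =>
    (Finset.prod_mul_prod_compl _ _).symm
  rw [pairingDen, h1, h2]
  simp only [Finset.prod_image hz.injOn, h3, Finset.prod_mul_distrib]
  ring

/-- The orthogonality relations of the weight functions. -/
lemma sum_Wplus_mul_Wminus (I J : II n k) :
    ∑ K : II n k, Wplus 1 I (lam n) (zAt K) z (y n) *
        (Wminus J (lam n) (zAt K) z (y n) * (Ring.inverse (R K) * Ring.inverse (Q K))) =
      if I = J then 1 else 0 := by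
  classical
  -- Without an index `y_ne_zero` does not apply; for n = 0 all products are empty and the single
  -- term is 1.
  rcases Nat.eq_zero_or_pos n with rfl | hn
  · have hI : ∀ K : II 0 k, K.1 = ∅ := fun K => Finset.eq_empty_of_isEmpty _
    obtain rfl : k = 0 := by rw [← I.2, hI]; rfl
    have : Subsingleton (II 0 0) := ⟨fun a b => Subtype.ext ((hI a).trans (hI b).symm)⟩
    rw [Fintype.sum_subsingleton _ I, if_pos (Subsingleton.elim _ _)]
    simp [Wplus, Wminus, Wσ, W, Cσ, e, R, Q, weightTerm, hI]
  let ι := algebraMap (L n) (FractionRing (L n))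
  have hι : Function.Injective ι := IsFractionRing.injective _ _
  let zz : Fin n → FractionRing (L n) := fun a => ι (z a)
  have hz : Function.Injective zz := hι.comp (z_injective n)
  have hy : ι (y n) ≠ 0 := (map_ne_zero_iff ι hι).2 (y_ne_zero ⟨0, hn⟩)
  have hg : ∀ a ∈ List.ofFn zz, ∀ b ∈ List.ofFn zz, a - b + ι (y n) ≠ 0 := by
    simp only [List.mem_ofFn', Set.mem_range]
    rintro _ ⟨a, rfl⟩ _ ⟨b, rfl⟩
    simpa only [zz, ← map_sub, ← map_add] using
      (map_ne_zero_iff ι hι).2 (isUnit_sub_add a b).ne_zero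
  have hZ : (List.ofFn zz).toFinset = Finset.univ.image zz := by
    ext; simp
  have himg : ∀ K : II n k, Finset.univ.image (fun r => ι (zAt K r)) = K.1.image zz := by
    intro K
    conv_rhs => rw [← image_elt K, Finset.image_image]
    rfl
  have hu : ∀ (K : II n k) a b, a ≠ b → IsUnit (zAt K a - zAt K b) := fun K a b h =>
    isUnit_zAt_sub K h
  have ht : ∀ K : II n k, Function.Injective fun r => ι (zAt K r) := fun K =>
    hι.comp (zAt_injective K)
  let D : FractionRing (L n) := weightProd
    (fun w => (ι (lam n) - w * ι (y n)) * (ι (lam n) - (w + 1) * ι (y n))) (I.1.image zz)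
    (List.ofFn zz)
  have hD : ι (Cσ 0 1 I (lam n) (y n) * Cσ 1 1 I (lam n) (y n)) = D := by
    have h1 : (Finset.univ.filter fun i => zz i ∈ I.1.image zz) = I.1 := by
      ext i; simp [hz.eq_iff]
    simp only [D, ← prod_weightProd _ _ _ zz, h1, sum_Ioi_image hz, C_one, map_mul, map_prod,
      Finset.prod_mul_distrib, map_sub, map_intCast]
    simp
  have hD0 : D ≠ 0 := by
    rw [← hD]
    exact (map_ne_zero_iff ι hι).2 ((isUnit_C 0 1 I).mul (isUnit_C 1 1 I)).ne_zero
  have hplus : ∀ K : II n k, ι (Wplus 1 I (lam n) (zAt K) z (y n)) =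
      wPlus (ι (lam n)) (ι (y n)) (I.1.image zz) (List.ofFn zz) (K.1.image zz) /
        (D * e (fun r => zz (elt K r)) (ι (y n))) := by
    intro K
    rw [Wplus, map_mul, map_inverse_of_isUnit ι
      (((isUnit_C 0 1 I).mul (isUnit_C 1 1 I)).mul (isUnit_e K)), Wσ, act_one_inv,
      map_W ι I _ _ _ _ (hu K), map_mul, hD, ← himg K, Ring.inverse_eq_inv', ← div_eq_mul_inv]
    congr 1
    · exact W_eq_wPlus I _ _ (ht K) hz
    · simp [e, zz, zAt]
  have hminus : ∀ K : II n k, ι (Wminus J (lam n) (zAt K) z (y n)) =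
      wMinus (ι (lam n)) (ι (y n)) (J.1.image zz) (List.ofFn zz) (K.1.image zz) /
        e (fun r => zz (elt K r)) (ι (y n)) := by
    intro K
    rw [Wminus, map_mul, map_inverse_of_isUnit ι (isUnit_e K), map_mul, map_pow, map_neg, map_one,
      Wσ, map_W ι _ _ _ _ _ (hu K), ← himg K, ← Wσ_rev_eq_wMinus J _ _ (ht K) hz,
      Ring.inverse_eq_inv', ← div_eq_mul_inv]
    congr 1
    · rw [Wσ, map_sub, map_neg, map_mul, map_intCast]
    · simp [e, zz, zAt]
  apply hι
  rw [map_sum]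
  have hmain := sum_wPlus_mul_wMinus (la := ι (lam n)) hy (I.1.image zz) (J.1.image zz)
    (List.ofFn zz) (List.nodup_ofFn.2 hz) hg
  have hsum : ∑ K : II n k, wPlus (ι (lam n)) (ι (y n)) (I.1.image zz) (List.ofFn zz) (K.1.image zz) *
      wMinus (ι (lam n)) (ι (y n)) (J.1.image zz) (List.ofFn zz) (K.1.image zz) /
        pairingDen (ι (y n)) (Finset.univ.image zz) (K.1.image zz) =
      ∑ K ∈ (List.ofFn zz).toFinset.powerset,
        wPlus (ι (lam n)) (ι (y n)) (I.1.image zz) (List.ofFn zz) K *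
          wMinus (ι (lam n)) (ι (y n)) (J.1.image zz) (List.ofFn zz) K /
            pairingDen (ι (y n)) (List.ofFn zz).toFinset K := by
    refine Finset.sum_of_injOn (fun K : II n k => K.1.image zz) ?_ ?_ ?_ ?_
    · intro K _ K' _ h
      exact Subtype.ext (Finset.image_injective hz h)
    · intro K _
      rw [hZ]
      simp
    -- Subsets of another cardinality contribute nothing, since the plus function vanishes there.
    · intro K hK hK'
      rw [hZ, Finset.mem_powerset] at hK
      obtain ⟨K, -, rfl⟩ := Finset.subset_image_iff.1 hK
      rw [wPlus_eq_zero, zero_mul, zero_div]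
      intro hc
      refine hK' ⟨⟨K, ?_⟩, by simp, rfl⟩
      rw [Finset.card_image_of_injective _ hz] at hc
      have h2 : ((List.ofFn zz).countP (· ∈ I.1.image zz)) = I.1.card := by
        rw [List.countP_eq_length_filter, ← List.toFinset_card_of_nodup
          ((List.nodup_ofFn.2 hz).filter _), ← Finset.card_image_of_injective I.1 hz]
        congr 1
        ext a
        simp only [List.mem_toFinset, List.mem_filter, List.mem_ofFn', Set.mem_range,
          decide_eq_true_eq, Finset.mem_image]
        constructor
        · exact fun h => h.2
        · rintro ⟨i, hi, rfl⟩
          exact ⟨⟨i, rfl⟩, i, hi, rfl⟩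
      rw [hc, h2, I.2]
    · intro K _
      rw [hZ]
  rw [← hsum] at hmain
  have hiff : (∀ a ∈ List.ofFn zz, (a ∈ I.1.image zz ↔ a ∈ J.1.image zz)) ↔ I = J := by
    constructor
    · intro h
      refine Subtype.ext (Finset.ext fun i => ?_)
      have := h (zz i) (by simp)
      rwa [hz.mem_finset_image, hz.mem_finset_image] at this
    · rintro rfl
      simp
  simp only [hiff] at hmain
  have hterm : ∀ K : II n k, ι (Wplus 1 I (lam n) (zAt K) z (y n) *
      (Wminus J (lam n) (zAt K) z (y n) * (Ring.inverse (R K) * Ring.inverse (Q K)))) =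
      D⁻¹ * (wPlus (ι (lam n)) (ι (y n)) (I.1.image zz) (List.ofFn zz) (K.1.image zz) *
        wMinus (ι (lam n)) (ι (y n)) (J.1.image zz) (List.ofFn zz) (K.1.image zz) /
          pairingDen (ι (y n)) (Finset.univ.image zz) (K.1.image zz)) := by
    intro K
    have hR : ι (R K) = ∏ a ∈ K.1, ∏ b ∈ K.1ᶜ, (zz a - zz b) := by simp [R, zz]
    have hQ : ι (Q K) = ∏ a ∈ K.1, ∏ b ∈ K.1ᶜ, (zz a - zz b + ι (y n)) := by simp [Q, zz]
    rw [map_mul, map_mul, map_mul, hplus, hminus, map_inverse_of_isUnit ι (isUnit_R K),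
      map_inverse_of_isUnit ι (isUnit_Q K), pairingDen_image hz, hR, hQ]
    simp only [Ring.inverse_eq_inv', div_eq_mul_inv, mul_inv]
    ring
  rw [Finset.sum_congr rfl fun K _ => hterm K, ← Finset.mul_sum, hmain]
  split_ifs
  · rw [map_one]
    exact inv_mul_cancel₀ hD0
  · simp

lemma sum_Wminus_mul_Wplus (K K' : II n k) :
    ∑ I : II n k, Wminus I (lam n) (zAt K) z (y n) * (Ring.inverse (R K) * Ring.inverse (Q K)) *
        Wplus 1 I (lam n) (zAt K') z (y n) = if K = K' then 1 else 0 := by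
  classical
  let M : Matrix (II n k) (II n k) (L n) := fun I K => Wplus 1 I (lam n) (zAt K) z (y n)
  let N : Matrix (II n k) (II n k) (L n) := fun K J =>
    Wminus J (lam n) (zAt K) z (y n) * (Ring.inverse (R K) * Ring.inverse (Q K))
  have hMN : M * N = 1 := by
    ext I J
    rw [Matrix.mul_apply, Matrix.one_apply, ← sum_Wplus_mul_Wminus]
  -- A one-sided inverse of a square matrix over a commutative ring is two-sided.
  have hNM : N * M = 1 := mul_eq_one_comm.1 hMN
  rw [← Matrix.one_apply, ← hNM, Matrix.mul_apply]

end Orthogonality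

/-! ### Injectivity of the restriction to the fixed points -/

section Reynolds

variable (n k : ℕ)

/-- The ideal of relations in `ℂ[Γ, z, y]`. -/
def relIdeal : Ideal (PΓ n k) :=
  Ideal.span (Set.range fun m => (relation n k m : PΓ n k))

/-- The averaging projection of `ℂ[Γ, z, y]` onto the invariants. -/
def reynolds : PΓ n k →ₗ[P n] invariants n k :=
  LinearMap.codRestrict (Subalgebra.toSubmodule (invariants n k))
    ((algebraMap ℂ (P n)
        ((Fintype.card (Equiv.Perm (Fin k) × Equiv.Perm (Fin (n - k))) : ℂ)⁻¹)) •
      ∑ g : Equiv.Perm (Fin k) × Equiv.Perm (Fin (n - k)),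
        (MvPolynomial.rename (R := P n) (Sum.map g.1 g.2)).toLinearMap) (by
    intro f
    rw [Subalgebra.mem_toSubmodule]
    intro s t
    simp only [LinearMap.smul_apply, LinearMap.sum_apply, AlgHom.toLinearMap_apply, map_smul,
      map_sum, MvPolynomial.rename_rename, Sum.map_comp_map]
    congr 1
    exact Fintype.sum_equiv (Equiv.mulLeft (s, t)) _ _ fun g => rfl)

variable {n k}

lemma reynolds_apply (f : PΓ n k) : (reynolds n k f : PΓ n k) =
    (algebraMap ℂ (P n)
        ((Fintype.card (Equiv.Perm (Fin k) × Equiv.Perm (Fin (n - k))) : ℂ)⁻¹)) •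
      ∑ g : Equiv.Perm (Fin k) × Equiv.Perm (Fin (n - k)),
        MvPolynomial.rename (Sum.map g.1 g.2) f := by
  change ((algebraMap ℂ (P n)
        ((Fintype.card (Equiv.Perm (Fin k) × Equiv.Perm (Fin (n - k))) : ℂ)⁻¹)) •
      ∑ g : Equiv.Perm (Fin k) × Equiv.Perm (Fin (n - k)),
        (MvPolynomial.rename (R := P n) (Sum.map g.1 g.2)).toLinearMap) f = _
  simp only [LinearMap.smul_apply, LinearMap.sum_apply, AlgHom.toLinearMap_apply]

lemma reynolds_mul (f : PΓ n k) (h : invariants n k) :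
    reynolds n k (f * h) = reynolds n k f * h := by
  refine Subtype.ext ?_
  rw [Subalgebra.coe_mul, reynolds_apply, reynolds_apply, smul_mul_assoc, Finset.sum_mul]
  congr 1
  refine Finset.sum_congr rfl fun g _ => ?_
  rw [map_mul, h.2 g.1 g.2]

lemma reynolds_one : reynolds n k 1 = 1 := by
  refine Subtype.ext ?_
  rw [reynolds_apply]
  simp only [map_one, Finset.sum_const, Finset.card_univ, ← Nat.cast_smul_eq_nsmul (P n), smul_smul]
  rw [← map_natCast (algebraMap ℂ (P n)), ← map_mul, inv_mul_cancel₀, map_one, one_smul]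
  · rfl
  · exact Nat.cast_ne_zero.2 Fintype.card_ne_zero

lemma reynolds_coe (h : invariants n k) : reynolds n k h = h := by
  rw [← one_mul (h : PΓ n k), reynolds_mul, reynolds_one, one_mul]

/-- Averaging is linear over the invariants and the relations are invariant, so it carries a
multiple of a relation to a multiple by an invariant. Hence averaging descends to the quotients. -/
lemma reynolds_mem {f : PΓ n k} (hf : f ∈ relIdeal n k) :
    reynolds n k f ∈ Ideal.span (Set.range (relation n k)) := by
  -- The claim is strengthened to all multiples a * f, since averaging does not commute with
  -- multiplication by non-invariants; a = 1 is taken at the end.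
  refine Submodule.span_induction (p := fun f _ =>
    ∀ a, reynolds n k (a * f) ∈ Ideal.span (Set.range (relation n k))) ?_ ?_ ?_ ?_ hf 1 |> fun h => by
      rwa [one_mul] at h
  · rintro _ ⟨m, rfl⟩ a
    rw [reynolds_mul]
    exact Ideal.mul_mem_left _ _ (Ideal.subset_span ⟨m, rfl⟩)
  · intro a
    simp
  · intro f g _ _ hf hg a
    rw [mul_add, map_add]
    exact add_mem (hf a) (hg a)
  · intro b f _ hf a
    rw [smul_eq_mul, ← mul_assoc]
    exact hf _

/-- `ℂ[Γ, z, y]` modulo the relations. -/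
def Full (n k : ℕ) : Type := PΓ n k ⧸ relIdeal n k

instance instCommRingFull (n k : ℕ) : CommRing (Full n k) := Ideal.Quotient.commRing _

instance instAlgebraFull (n k : ℕ) : Algebra (P n) (Full n k) :=
  Ideal.Quotient.algebra (P n) (A := PΓ n k)

/-- The class of a polynomial in the `γ` modulo the relations. -/
def fullMk (n k : ℕ) : PΓ n k →ₐ[P n] Full n k := Ideal.Quotient.mkₐ (P n) (relIdeal n k)

lemma fullMk_eq_zero {f : PΓ n k} (hf : f ∈ relIdeal n k) : fullMk n k f = 0 :=
  Ideal.Quotient.eq_zero_iff_mem.2 hf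

/-- The map from the cohomology ring to `ℂ[Γ, z, y]` modulo the relations. -/
def toFull (n k : ℕ) : H n k →ₐ[P n] Full n k :=
  Ideal.Quotient.liftₐ _ ((fullMk n k).comp (invariants n k).val) (by
    intro a ha
    have hle : Ideal.span (Set.range (relation n k)) ≤
        RingHom.ker ((fullMk n k).comp (invariants n k).val) := by
      rw [Ideal.span_le]
      rintro _ ⟨m, rfl⟩
      exact fullMk_eq_zero (Ideal.subset_span ⟨m, rfl⟩)
    exact hle ha)

/-- The projection of an invariant to its class, as a linear map. -/
def clsₗ (n k : ℕ) : invariants n k →ₗ[P n] H n k :=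
  (Ideal.Quotient.mkₐ (P n) (Ideal.span (Set.range (relation n k)))).toLinearMap

/-- The retraction of `toFull` given by averaging. -/
def ofFull (n k : ℕ) : Full n k →ₗ[P n] H n k where
  toFun x := Quotient.liftOn' x (fun f => clsₗ n k (reynolds n k f)) fun f g hfg => by
    have h : f - g ∈ relIdeal n k := Ideal.Quotient.eq.1 (Quotient.sound' hfg)
    have h2 := reynolds_mem h
    rw [map_sub] at h2
    exact Ideal.Quotient.eq.2 h2
  map_add' x y := by
    induction x using Quotient.inductionOn'
    induction y using Quotient.inductionOn'
    change clsₗ n k (reynolds n k (_ + _)) = clsₗ n k _ + clsₗ n k _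
    rw [map_add, map_add]
  map_smul' c x := by
    induction x using Quotient.inductionOn'
    change clsₗ n k (reynolds n k (c • _)) = c • clsₗ n k _
    rw [map_smul, map_smul]

lemma ofFull_toFull (x : H n k) : ofFull n k (toFull n k x) = x := by
  obtain ⟨f, rfl⟩ := Ideal.Quotient.mk_surjective x
  change cls (reynolds n k f) = cls f
  rw [reynolds_coe]

/-- A split injection stays injective after any base change. -/
lemma lTensor_toFull_injective :
    Function.Injective (LinearMap.lTensor (L n) (toFull n k).toLinearMap) := by
  have h : Function.LeftInverse (LinearMap.lTensor (L n) (ofFull n k))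
      (LinearMap.lTensor (L n) (toFull n k).toLinearMap) := by
    intro x
    have h2 : ofFull n k ∘ₗ (toFull n k).toLinearMap = LinearMap.id :=
      LinearMap.ext ofFull_toFull
    rw [← LinearMap.comp_apply, ← LinearMap.lTensor_comp, h2, LinearMap.lTensor_id,
      LinearMap.id_apply]
  exact h.injective

end Reynolds

/-! ### Idempotents from Lagrange interpolation. -/

section Interpolation

variable {n : ℕ}

open Polynomial in
/-- The Lagrange basis polynomials at the nodes `z_a`, over `𝓛`. -/
def lagrangeL (a : Fin n) : (L n)[X] :=
  ∏ b ∈ Finset.univ.erase a, (C (Ring.inverse (z a - z b)) * (X - C (z b)))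

open Polynomial in
lemma sum_lagrangeL (a : Fin n) : ∑ b : Fin n, lagrangeL b = 1 := by
  let ι := algebraMap (L n) (FractionRing (L n))
  have hι : Function.Injective ι := IsFractionRing.injective _ _
  refine map_injective ι hι ?_
  have h := Lagrange.sum_basis (s := (Finset.univ : Finset (Fin n))) (v := fun b => ι (z b))
    (hι.comp (z_injective n)).injOn ⟨a, Finset.mem_univ a⟩
  rw [Polynomial.map_one, ← h, Polynomial.map_sum]
  refine Finset.sum_congr rfl fun b _ => ?_
  rw [lagrangeL, Polynomial.map_prod, Lagrange.basis]
  refine Finset.prod_congr rfl fun c hc => ?_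
  rw [Lagrange.basisDivisor, Polynomial.map_mul, map_C, Polynomial.map_sub, map_X, map_C,
    map_inverse_of_isUnit ι (isUnit_sub (Finset.ne_of_mem_erase hc).symm), Ring.inverse_eq_inv',
    map_sub]

variable {A γ : Type*} [CommRing A] [Algebra (L n) A] [Fintype γ] [DecidableEq γ]

/-- The idempotent which splits off the point with coordinates `g i = z_{φ(i)}`. -/
def pointIdem (g : γ → A) (φ : γ → Fin n) : A := ∏ i, Polynomial.aeval (g i) (lagrangeL (φ i))

/-- Expansion of the product over i of the sums of all Lagrange polynomials at g i, each equal to 1.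
The map `f` provides a node whenever there is an index i. -/
lemma sum_pointIdem (g : γ → A) (f : γ → Fin n) : ∑ φ : γ → Fin n, pointIdem g φ = 1 := by
  simp only [pointIdem]
  have h := Finset.prod_univ_sum (fun _ : γ => (Finset.univ : Finset (Fin n)))
    (fun i a => Polynomial.aeval (g i) (lagrangeL a))
  rw [Fintype.piFinset_univ] at h
  rw [← h]
  refine Finset.prod_eq_one fun i _ => ?_
  rw [← map_sum, sum_lagrangeL (f i), map_one]

variable {g : γ → A}

/-- Each g i is a root of ∏ (u - z_a), of which (u - z_a) times the Lagrange polynomial at z_a is a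
scalar multiple. -/
lemma mul_pointIdem (hg : ∀ u : A, ∏ i, (u - g i) = ∏ a : Fin n, (u - algebraMap (L n) A (z a)))
    (φ : γ → Fin n) (i : γ) :
    g i * pointIdem g φ = algebraMap (L n) A (z (φ i)) * pointIdem g φ := by
  have h1 : (g i - algebraMap (L n) A (z (φ i))) * Polynomial.aeval (g i) (lagrangeL (φ i)) = 0 := by
    have h2 : ∏ a : Fin n, (g i - algebraMap (L n) A (z a)) = 0 := by
      rw [← hg]
      exact Finset.prod_eq_zero (Finset.mem_univ i) (sub_self _)
    rw [← Finset.mul_prod_erase _ _ (Finset.mem_univ (φ i))] at h2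
    rw [lagrangeL, Finset.prod_mul_distrib, map_mul, map_prod _ _ (Finset.univ.erase (φ i)),
      map_prod _ (fun b => Polynomial.X - Polynomial.C (z b))]
    simp only [map_sub, Polynomial.aeval_X, Polynomial.aeval_C]
    rw [mul_left_comm, h2, mul_zero]
  rw [← sub_eq_zero, ← sub_mul, pointIdem, ← Finset.mul_prod_erase _ _ (Finset.mem_univ i),
    ← mul_assoc, h1, zero_mul]

/-- If φ misses b, then ∏ (z_b - g i) is zero by the relation at u = z_b, but acts on the idempotent
as the unit ∏ (z_b - z_{φ i}). -/
lemma pointIdem_eq_zero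
    (hg : ∀ u : A, ∏ i, (u - g i) = ∏ a : Fin n, (u - algebraMap (L n) A (z a)))
    {φ : γ → Fin n} (hφ : ¬ Function.Surjective φ) : pointIdem g φ = 0 := by
  obtain ⟨b, hb⟩ : ∃ b, ∀ i, φ i ≠ b := by simpa [Function.Surjective] using hφ
  have h1 : ∏ i, (algebraMap (L n) A (z b) - g i) = 0 := by
    rw [hg]
    exact Finset.prod_eq_zero (Finset.mem_univ b) (sub_self _)
  have h2 : ∀ s : Finset γ, (∏ i ∈ s, (algebraMap (L n) A (z b) - g i)) * pointIdem g φ =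
      algebraMap (L n) A (∏ i ∈ s, (z b - z (φ i))) * pointIdem g φ := by
    intro s
    induction s using Finset.induction_on with
    | empty => simp
    | insert i s hi ih =>
      rw [Finset.prod_insert hi, Finset.prod_insert hi, mul_assoc, ih, mul_left_comm, sub_mul,
        mul_pointIdem hg, map_mul, map_sub]
      ring
  have hu : IsUnit (∏ i, (z b - z (φ i)) : L n) := by
    rw [IsUnit.prod_univ_iff]
    exact fun i => isUnit_sub (hb i).symm
  have h3 := h2 Finset.univ
  rw [h1, zero_mul] at h3
  exact ((hu.map (algebraMap (L n) A)).mul_right_eq_zero).1 h3.symm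

end Interpolation

/-! ### Classes over 𝓛 are determined at the fixed points. -/

section Injectivity

variable {n k : ℕ}

/-- `ℂ[Γ, z, y]` modulo the relations, with coefficients extended to `𝓛`. -/
abbrev FullL (n k : ℕ) : Type := L n ⊗[P n] Full n k

/-- The class of a polynomial in the `γ`, with coefficients extended to `𝓛`. -/
def fullCls (n k : ℕ) : PΓ n k →ₐ[P n] FullL n k :=
  Algebra.TensorProduct.includeRight.comp (fullMk n k)

lemma algebraMap_fullL (p : P n) :
    algebraMap (P n) (FullL n k) p = algebraMap (L n) (FullL n k) (algebraMap (P n) (L n) p) :=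
  IsScalarTower.algebraMap_apply (P n) (L n) (FullL n k) p

/-- The images of the variables `γ`. -/
def fullVar (n k : ℕ) (i : Fin k ⊕ Fin (n - k)) : FullL n k := fullCls n k (MvPolynomial.X i)

lemma prod_sub_fullVar (u : FullL n k) :
    ∏ i, (u - fullVar n k i) = ∏ a : Fin n, (u - algebraMap (L n) (FullL n k) (z a)) := by
  have h : (relationPoly n k).map (fullCls n k : PΓ n k →+* FullL n k) = 0 := by
    ext m
    rw [Polynomial.coeff_map, Polynomial.coeff_zero]
    change Algebra.TensorProduct.includeRight (fullMk n k ((relationPoly n k).coeff m)) = _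
    rw [fullMk_eq_zero (f := (relationPoly n k).coeff m) (Ideal.subset_span ⟨m, rfl⟩), map_zero]
  have h2 := congrArg (Polynomial.eval u) h
  simp only [relationPoly, Polynomial.map_sub, Polynomial.map_mul, Polynomial.map_prod,
    Polynomial.map_X, Polynomial.map_C, RingHom.coe_coe, Polynomial.eval_sub,
    Polynomial.eval_mul, Polynomial.eval_prod, Polynomial.eval_X, Polynomial.eval_C,
    Polynomial.eval_zero] at h2
  simp only [Fintype.prod_sum_type, fullVar]
  rw [sub_eq_zero.1 h2]
  refine Finset.prod_congr rfl fun a _ => ?_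
  rw [z, ← algebraMap_fullL, ← (fullCls n k).commutes]
  rfl

lemma fullCls_mul_pointIdem (φ : Fin k ⊕ Fin (n - k) → Fin n) (f : PΓ n k) :
    fullCls n k f * pointIdem (fullVar n k) φ =
      algebraMap (P n) (FullL n k) (MvPolynomial.aeval (fun i => zP (φ i)) f) *
        pointIdem (fullVar n k) φ := by
  induction f using MvPolynomial.induction_on with
  | C p =>
    rw [MvPolynomial.aeval_C, ← MvPolynomial.algebraMap_eq, (fullCls n k).commutes]
    rfl
  | add f g hf hg => rw [map_add, map_add, map_add, add_mul, add_mul, hf, hg]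
  | mul_X f i hf =>
    rw [map_mul, mul_assoc, map_mul, map_mul, MvPolynomial.aeval_X, algebraMap_fullL (zP (φ i))]
    change _ * (fullVar n k i * _) = _
    rw [mul_pointIdem prod_sub_fullVar, mul_left_comm, hf]
    change _ = _ * algebraMap (L n) (FullL n k) (z (φ i)) * _
    ring

/-- J is the image of the first block. Within the two blocks φ need not be increasing; the
invariance of f absorbs the two permutations. -/
lemma aeval_eq_subst {φ : Fin k ⊕ Fin (n - k) → Fin n} (hφ : Function.Bijective φ) :
    ∃ J : II n k, ∀ f : invariants n k,
      MvPolynomial.aeval (fun i => zP (φ i)) (f : PΓ n k) = subst J (f : PΓ n k) := by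
  classical
  let J : II n k := ⟨Finset.univ.image fun i => φ (Sum.inl i), by
    rw [Finset.card_image_of_injective _ fun a b h => Sum.inl_injective (hφ.1 h)]; simp⟩
  have h1 : ∀ i, ∃ r, elt J r = φ (Sum.inl i) := fun i =>
    (exists_elt_eq J _).2 (Finset.mem_image_of_mem _ (Finset.mem_univ i))
  have h2 : ∀ j, ∃ r, elt (compl J) r = φ (Sum.inr j) := fun j =>
    (exists_elt_eq (compl J) _).2 (by simp [compl, J, hφ.1.eq_iff])
  choose s hs using h1
  choose t ht using h2
  have hs' : Function.Injective s := fun a b hab => Sum.inl_injective (hφ.1 (by rw [← hs, ← hs, hab]))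
  have ht' : Function.Injective t := fun a b hab => Sum.inr_injective (hφ.1 (by rw [← ht, ← ht, hab]))
  refine ⟨J, fun f => ?_⟩
  have hf := f.2 (Equiv.ofBijective s (Finite.injective_iff_bijective.1 hs'))
    (Equiv.ofBijective t (Finite.injective_iff_bijective.1 ht'))
  conv_rhs => rw [← hf]
  rw [subst, MvPolynomial.aeval_rename]
  congr 2
  funext i
  rcases i with i | j
  · simp [hs]
  · simp [ht]

lemma lTensor_toFull_mul_pointIdem {φ : Fin k ⊕ Fin (n - k) → Fin n} (hφ : Function.Bijective φ) :
    ∃ J : II n k, ∀ x : HL n k,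
      LinearMap.lTensor (L n) (toFull n k).toLinearMap x * pointIdem (fullVar n k) φ =
        algebraMap (L n) (FullL n k) (restr J x) * pointIdem (fullVar n k) φ := by
  obtain ⟨J, hJ⟩ := aeval_eq_subst hφ
  refine ⟨J, fun x => ?_⟩
  induction x using TensorProduct.induction_on with
  | zero => simp
  | add x y hx hy => rw [map_add, map_add, map_add, add_mul, add_mul, hx, hy]
  | tmul c h =>
    obtain ⟨f, rfl⟩ := Ideal.Quotient.mk_surjective h
    change (c ⊗ₜ[P n] (fullMk n k (f : PΓ n k)) : FullL n k) * _ =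
      algebraMap (L n) (FullL n k) (restr J (c ⊗ₜ cls f)) * _
    have h1 : (c ⊗ₜ[P n] (fullMk n k (f : PΓ n k)) : FullL n k) =
        algebraMap (L n) (FullL n k) c * fullCls n k f := by
      rw [← Algebra.smul_def]
      change _ = c • ((1 : L n) ⊗ₜ[P n] fullMk n k f : FullL n k)
      rw [TensorProduct.smul_tmul', smul_eq_mul, mul_one]
    rw [h1, restr_tmul, mul_assoc, fullCls_mul_pointIdem, hJ, map_mul, algebraMap_fullL, mul_assoc]

/-- A class is determined by its restrictions to the fixed points. -/
lemma eq_of_restr_eq {x x' : HL n k} (hk : k ≤ n) (h : ∀ J, restr J x = restr J x') : x = x' := by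
  apply lTensor_toFull_injective
  let f : Fin k ⊕ Fin (n - k) → Fin n := fun i => (finSumFinEquiv i).cast (by omega)
  rw [← mul_one (LinearMap.lTensor (L n) (toFull n k).toLinearMap x),
    ← mul_one (LinearMap.lTensor (L n) (toFull n k).toLinearMap x'),
    ← sum_pointIdem (fullVar n k) f, Finset.mul_sum, Finset.mul_sum]
  refine Finset.sum_congr rfl fun φ _ => ?_
  -- There are k + (n - k) = n variables, so a surjective φ is bijective and belongs to a fixed
  -- point; the other terms vanish.
  by_cases hφ : Function.Surjective φ
  · obtain ⟨J, hJ⟩ := lTensor_toFull_mul_pointIdem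
      ((Fintype.bijective_iff_surjective_and_card φ).2 ⟨hφ, by simp; omega⟩)
    rw [hJ, hJ, h]
  · rw [pointIdem_eq_zero prod_sub_fullVar hφ, mul_zero, mul_zero]

end Injectivity

/-! ### The two compositions. -/

section Main

variable {n : ℕ}

lemma nu_incl (k : Fin (n + 1)) (x : HL n k) :
    nu n (incl k x) = ∑ I : II n k, (restr I x * Ring.inverse (R I)) • xi I := by
  simp only [nu, incl, LinearMap.sum_apply, LinearMap.smulRight_apply, LinearMap.comp_apply,
    LinearMap.proj_apply, LinearMap.single_apply, AlgHom.toLinearMap_apply, mul_smul]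
  rw [Finset.sum_eq_single_of_mem k (Finset.mem_univ k)]
  · simp
  · intro k' _ hk
    simp [Pi.single_eq_of_ne hk]

lemma nu_Stab_v {k : Fin (n + 1)} (I : II n k) : nu n (Stab 1 (v I.1)) = v I.1 := by
  rw [Stab_v, nu_incl]
  simp only [restr_kappa, xi, Finset.smul_sum, smul_smul]
  rw [Finset.sum_comm]
  have h : ∀ J : II n k, ∑ K : II n k, (Wplus 1 I (lam n) (zAt K) z (y n) * Ring.inverse (R K) *
      (Ring.inverse (Q K) * Wminus J (lam n) (zAt K) z (y n))) • v J.1 =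
        (if I = J then (1 : L n) else 0) • v J.1 := by
    intro J
    rw [← Finset.sum_smul, ← sum_Wplus_mul_Wminus]
    congr 1
    exact Finset.sum_congr rfl fun K _ => by ring
  simp [Finset.sum_congr rfl fun J _ => h J]

/-- Both classes restrict at x_J to R_I if I = J and to 0 otherwise; on the left this is the second
orthogonality, the factor Q_I cancelling. -/
lemma Stab_xi (k : Fin (n + 1)) (I : II n k) :
    Stab 1 (xi I) = incl k (1 ⊗ₜ[P n] cls (fixedPoly I)) := by
  simp only [xi, map_smul, map_sum, Stab_v]
  simp only [← map_smul, ← map_sum]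
  congr 1
  refine eq_of_restr_eq (Nat.lt_succ_iff.1 k.2) fun J => ?_
  simp only [map_smul, map_sum, restr_kappa, restr_tmul, one_mul, smul_eq_mul, subst_fixedPoly]
  have h : ∑ K : II n k, Wminus K (lam n) (zAt I) z (y n) * Wplus 1 K (lam n) (zAt J) z (y n) =
      R I * Q I * if I = J then 1 else 0 := by
    rw [← sum_Wminus_mul_Wplus, Finset.mul_sum]
    refine Finset.sum_congr rfl fun K _ => ?_
    linear_combination (-(Wminus K (lam n) (zAt I) z (y n) *
      Wplus 1 K (lam n) (zAt J) z (y n))) * (Ring.mul_inverse_cancel _ (isUnit_R I)) -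
      (Wminus K (lam n) (zAt I) z (y n) * Wplus 1 K (lam n) (zAt J) z (y n) * R I *
        Ring.inverse (R I)) * (Ring.mul_inverse_cancel _ (isUnit_Q I))
  rw [h]
  split_ifs
  · linear_combination R I * Ring.mul_inverse_cancel _ (isUnit_Q I)
  · simp

/-- By `Stab_xi` the left side is the interpolation of x from its restrictions, the class of
`fixedPoly I` restricting to R_I at x_I and to 0 at the other fixed points. -/
lemma Stab_nu_incl (k : Fin (n + 1)) (x : HL n k) : Stab 1 (nu n (incl k x)) = incl k x := by
  simp only [nu_incl, map_sum, map_smul, Stab_xi]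
  simp only [← map_smul, ← map_sum]
  congr 1
  refine eq_of_restr_eq (Nat.lt_succ_iff.1 k.2) fun J => ?_
  simp only [map_smul, map_sum, restr_tmul, one_mul, smul_eq_mul, subst_fixedPoly, mul_ite,
    mul_zero, Finset.sum_ite_eq', Finset.mem_univ, if_true]
  rw [mul_assoc, Ring.inverse_mul_cancel _ (isUnit_R J), mul_one]

end Main

end DynStab

end

theorem mainTheorem4 (n : ℕ) :
    (∀ (k : Fin (n + 1)) (c : DynStab.L n) (f : DynStab.invariants n k),
      DynStab.nu n (DynStab.incl k (c ⊗ₜ[DynStab.P n] DynStab.cls f)) =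
        ∑ I : DynStab.II n k,
          (c * algebraMap (DynStab.P n) (DynStab.L n) (DynStab.subst I f.1) *
            Ring.inverse (DynStab.R I)) • DynStab.xi I) ∧
    DynStab.nu n ∘ₗ DynStab.Stab 1 = LinearMap.id ∧
    DynStab.Stab 1 ∘ₗ DynStab.nu n = LinearMap.id ∧
    ∀ (k : Fin (n + 1)) (I : DynStab.II n k),
      DynStab.Stab 1 (DynStab.xi I) =
        DynStab.incl k (1 ⊗ₜ[DynStab.P n] DynStab.cls (DynStab.fixedPoly I)) := by
  refine ⟨fun k c f => ?_, ?_, ?_, DynStab.Stab_xi⟩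
  · rw [DynStab.nu_incl]
    simp only [DynStab.restr_tmul]
  · refine (DynStab.vBasis n).ext fun I => ?_
    rw [DynStab.vBasis_apply, LinearMap.comp_apply, LinearMap.id_apply]
    exact DynStab.nu_Stab_v (k := DynStab.size I) ⟨I, rfl⟩
  · refine LinearMap.pi_ext' fun k => LinearMap.ext fun x => ?_
    exact DynStab.Stab_nu_incl k x
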